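/- **Theorem (confidence intervals for homogeneous matching functions).** Let $\mathcal X,\mathcal Y$ be finite sets of types and let $\mathcal{XY}_0=(\mathcal X\times\mathcal Y)\cup(\mathcal X\times\{0\})\cup(\{0\}\times\mathcal Y)$ be the set of household types. Let $\Theta\subseteq\mathbb R^d$, and for $\theta\in\Theta$, $(x,y)\in\mathcal X\times\mathcal Y$ let $M^\theta_{xy}:(0,\infty)^2\to(0,\infty)$ be a matching function that is continuous, weakly increasing in its two arguments, tends to $0$ when one argument tends to $0^+$ and the other is fixed, and is homogeneous of degree $1$. Assume that $(\theta,a,b)\mapsto M^\theta_{xy}(a,b)$ is $C^2$ on $\operatorname{int}(\Theta)\times(0,\infty)^2$. For $s=((s_{x0})_x,(s_{0y})_y)$ with positive entries let $M^\theta(s)\in\mathbb R^{\mathcal{XY}_0}$ have entries $M^\theta_{xy}(s_{x0},s_{0y})$, $s_{x0}$, $s_{0y}$. Let $A$ be the matrix with $(A\mu)_x=\mu_{x0}+\sum_y\mu_{xy}$ and $(A\mu)_y=\mu_{0y}+\sum_x\mu_{xy}$. For a vector $\zeta$ of positive margins, let $\Pi(\theta,\zeta)=M^\theta(s)/(1'M^\theta(s))$,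 where $s$ is the unique positive solution of $AM^\theta(s)=\zeta$. Let $\theta_0\in\operatorname{int}(\Theta)$, let $(n_x)_x,(m_y)_y$ be positive masses, put $\pi=\Pi(\theta_0,(n,m))$ and $\zeta=A\pi$ (so that $\Pi(\theta_0,\zeta)=\pi$). Assume that $\theta_0$ is identified as the unique parameter in $\Theta$ rationalizing $\pi$, in the well-separated sense: for every neighbourhood $U$ of $\theta_0$ there are neighbourhoods $V$ of $\zeta$ and $W$ of $\pi$ such that $\theta\in\Theta$, $\zeta'\in V$ and $\Pi(\theta,\zeta')\in W$ imply $\theta\in U$. With Jacobians evaluated at $(\theta_0,\zeta)$, let $$\mathcal I_{11}=(D_\theta\log\Pi)'\operatorname{diag}(\pi)(D_\theta\log\Pi),\quad \mathcal I_{12}=(D_\theta\log\Pi)'\operatorname{diag}(\pi)(D_\zeta\log\Pi),\quad V_\pi=\operatorname{diag}(\pi)-\pi\pi',$$ and assume that $\mathcal I_{11}$ is invertible. Let $\hat\pi_N$ be the vector of frequencies of the household types among $N$ independent households drawn from $\pi$, and let $\hat\theta_N$ be random vectors that, with probability tending to $1$ as $N\to\infty$, are maximum likelihood estimates with $\zeta$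 replaced by $A\hat\pi_N$, that is, maximize over $\theta\in\Theta$ $$\sum_{h\in\mathcal{XY}_0}\hat\pi_{N,h}\log\Pi_h(\theta,A\hat\pi_N).$$ Then $\theta\mapsto\log\Pi(\theta,\zeta)$ is differentiable at $\theta_0$, $\zeta'\mapsto\log\Pi(\theta_0,\zeta')$ is differentiable at $\zeta$, the matrix $$V_\theta=\mathcal I_{11}^{-1}+\mathcal I_{11}^{-1}\mathcal I_{12}AV_\pi A'\mathcal I_{12}'\mathcal I_{11}^{-1}$$ is positive semidefinite, and $N^{1/2}(\hat\theta_N-\theta_0)$ converges in distribution to $\mathcal N(0,V_\theta)$. -/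

import Mathlib

open MeasureTheory ProbabilityTheory Filter Topology

/-- Household types: couples `(x, y)`, single men of type `x`, single women of type `y`. -/
inductive Household (X Y : Type*) where
  | couple (x : X) (y : Y) : Household X Y
  | man (x : X) : Household X Y
  | woman (y : Y) : Household X Y

namespace Household

/-- The set of household types is `X × Y ∪ X ∪ Y`. -/
def equivSum (X Y : Type*) : Household X Y ≃ (X × Y) ⊕ (X ⊕ Y) where
  toFun
    | couple x y => .inl (x, y)
    | man x => .inr (.inl x)
    | woman y => .inr (.inr y)
  invFun
    | .inl p => couple p.1 p.2
    | .inr (.inl x) => man x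
    | .inr (.inr y) => woman y
  left_inv h := by cases h <;> rfl
  right_inv s := by rcases s with p | x | y <;> rfl

instance {X Y : Type*} [Fintype X] [Fintype Y] : Fintype (Household X Y) :=
  Fintype.ofEquiv _ (equivSum X Y).symm

instance {X Y : Type*} [DecidableEq X] [DecidableEq Y] : DecidableEq (Household X Y) :=
  (equivSum X Y).injective.decidableEq

/-- Household types form a finite set, with the discrete σ-algebra. -/
instance {X Y : Type*} : MeasurableSpace (Household X Y) := ⊤

end Household

namespace MatchingMLE

section Model

variable {X Y : Type*} [Fintype X] [Fintype Y] [DecidableEq X] [DecidableEq Y]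

/-- The assumptions on one (pair-specific) aggregate matching function
`(μ_{x0}, μ_{0y}) ↦ M_{xy}(μ_{x0}, μ_{0y})`, on positive masses of singles. -/
structure IsMatchingFunction (f : ℝ → ℝ → ℝ) : Prop where
  pos : ∀ a b, 0 < a → 0 < b → 0 < f a b
  continuousOn : ContinuousOn (fun p : ℝ × ℝ => f p.1 p.2) (Set.Ioi 0 ×ˢ Set.Ioi 0)
  isotone : ∀ a a' b b', 0 < a → 0 < b → a ≤ a' → b ≤ b' → f a b ≤ f a' b'
  tendsto_right : ∀ a, 0 < a → Tendsto (fun b => f a b) (𝓝[>] 0) (𝓝 0)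
  tendsto_left : ∀ b, 0 < b → Tendsto (fun a => f a b) (𝓝[>] 0) (𝓝 0)

/-- Homogeneity of degree one (constant returns to scale). -/
def IsHomogeneousOne (f : ℝ → ℝ → ℝ) : Prop :=
  ∀ c a b, 0 < c → 0 < a → 0 < b → f (c * a) (c * b) = c * f a b

/-- The masses of all household types, given the masses `s` of singles
(`s (inl x) = μ_{x0}`, `s (inr y) = μ_{0y}`). -/
def householdMass (M : X → Y → ℝ → ℝ → ℝ) (s : X ⊕ Y → ℝ) : Household X Y → ℝ
  | .couple x y => M x y (s (.inl x)) (s (.inr y))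
  | .man x => s (.inl x)
  | .woman y => s (.inr y)

/-- The margin matrix `A`: `(A μ)_x = μ_{x0} + ∑_y μ_{xy}`, `(A μ)_y = μ_{0y} + ∑_x μ_{xy}`. -/
def marginMatrix (X Y : Type*) [DecidableEq X] [DecidableEq Y] :
    Matrix (X ⊕ Y) (Household X Y) ℝ
  | .inl x, .couple x' _ => if x = x' then 1 else 0
  | .inl x, .man x' => if x = x' then 1 else 0
  | .inl _, .woman _ => 0
  | .inr y, .couple _ y' => if y = y' then 1 else 0
  | .inr _, .man _ => 0
  | .inr y, .woman y' => if y = y' then 1 else 0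

/-- `s` solves the accounting system `A M(s) = ζ`, with positive masses of singles. -/
def IsEquilibrium (M : X → Y → ℝ → ℝ → ℝ) (ζ s : X ⊕ Y → ℝ) : Prop :=
  (∀ z, 0 < s z) ∧ (marginMatrix X Y).mulVec (householdMass M s) = ζ

open Classical in
/-- The equilibrium masses of singles, as a function of the margins. -/
noncomputable def eqSingles (M : X → Y → ℝ → ℝ → ℝ) (ζ : X ⊕ Y → ℝ) : X ⊕ Y → ℝ :=
  if h : ∃ s, IsEquilibrium M ζ s then h.choose else 0

/-- The predicted frequencies `Π(ζ)`: the equilibrium masses of the household types, divided by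
the total number of households. -/
noncomputable def predFreq (M : X → Y → ℝ → ℝ → ℝ) (ζ : X ⊕ Y → ℝ) (h : Household X Y) : ℝ :=
  householdMass M (eqSingles M ζ) h / ∑ h', householdMass M (eqSingles M ζ) h'

variable {d : ℕ}

/-- The log-likelihood `l(p | θ, ζ) = ∑ p_{xy} log Π_{xy}(θ, ζ)`. -/
noncomputable def logLik (M : EuclideanSpace ℝ (Fin d) → X → Y → ℝ → ℝ → ℝ)
    (p : Household X Y → ℝ) (θ : EuclideanSpace ℝ (Fin d)) (ζ : X ⊕ Y → ℝ) : ℝ :=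
  ∑ h, p h * Real.log (predFreq (M θ) ζ h)

/-- `θ` is a maximum likelihood estimate in `Θ` from the observed frequencies `p`, with `ζ`
replaced by `A p`. -/
def IsMLE (M : EuclideanSpace ℝ (Fin d) → X → Y → ℝ → ℝ → ℝ)
    (Θ : Set (EuclideanSpace ℝ (Fin d))) (p : Household X Y → ℝ)
    (θ : EuclideanSpace ℝ (Fin d)) : Prop :=
  θ ∈ Θ ∧ ∀ θ' ∈ Θ,
    logLik M p θ' ((marginMatrix X Y).mulVec p) ≤ logLik M p θ ((marginMatrix X Y).mulVec p)

/-- `θ₀` is the only parameter in `Θ` which rationalizes the frequencies `π`, in the well-separated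
sense: a parameter in `Θ` that produces frequencies close to `π` from margins close to `A π` is
close to `θ₀`. -/
def IsIdentified (M : EuclideanSpace ℝ (Fin d) → X → Y → ℝ → ℝ → ℝ)
    (Θ : Set (EuclideanSpace ℝ (Fin d))) (θ₀ : EuclideanSpace ℝ (Fin d))
    (π : Household X Y → ℝ) : Prop :=
  ∀ U ∈ 𝓝 θ₀, ∃ V ∈ 𝓝 ((marginMatrix X Y).mulVec π), ∃ W ∈ 𝓝 π,
    ∀ θ ∈ Θ, ∀ ζ ∈ V, predFreq (M θ) ζ ∈ W → θ ∈ U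

/-- The frequencies of the household types among the first `N` sampled households. -/
noncomputable def empFreq {Ω : Type*} (H : ℕ → Ω → Household X Y) (N : ℕ) (ω : Ω)
    (h : Household X Y) : ℝ :=
  ((Finset.range N).filter (fun i => H i ω = h)).card / (N : ℝ)

/-- The Jacobian `D_θ log Π` at `(θ, ζ)`. -/
noncomputable def dThetaLog (M : EuclideanSpace ℝ (Fin d) → X → Y → ℝ → ℝ → ℝ)
    (θ : EuclideanSpace ℝ (Fin d)) (ζ : X ⊕ Y → ℝ) : Matrix (Household X Y) (Fin d) ℝ :=
  fun h k => fderiv ℝ (fun t => Real.log (predFreq (M t) ζ h)) θ (EuclideanSpace.single k 1)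

/-- The Jacobian `D_ζ log Π` at `(θ, ζ)`. -/
noncomputable def dZetaLog (M : EuclideanSpace ℝ (Fin d) → X → Y → ℝ → ℝ → ℝ)
    (θ : EuclideanSpace ℝ (Fin d)) (ζ : X ⊕ Y → ℝ) : Matrix (Household X Y) (X ⊕ Y) ℝ :=
  fun h z => fderiv ℝ (fun q => Real.log (predFreq (M θ) q h)) ζ (Pi.single z 1)

/-- `I₁₁ = (D_θ log Π)' diag(π) (D_θ log Π)`, with the margins `ζ = A π`. -/
noncomputable def info11 (M : EuclideanSpace ℝ (Fin d) → X → Y → ℝ → ℝ → ℝ)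
    (θ : EuclideanSpace ℝ (Fin d)) (π : Household X Y → ℝ) : Matrix (Fin d) (Fin d) ℝ :=
  (dThetaLog M θ ((marginMatrix X Y).mulVec π)).transpose * Matrix.diagonal π *
    dThetaLog M θ ((marginMatrix X Y).mulVec π)

/-- `I₁₂ = (D_θ log Π)' diag(π) (D_ζ log Π)`, with the margins `ζ = A π`. -/
noncomputable def info12 (M : EuclideanSpace ℝ (Fin d) → X → Y → ℝ → ℝ → ℝ)
    (θ : EuclideanSpace ℝ (Fin d)) (π : Household X Y → ℝ) : Matrix (Fin d) (X ⊕ Y) ℝ :=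
  (dThetaLog M θ ((marginMatrix X Y).mulVec π)).transpose * Matrix.diagonal π *
    dZetaLog M θ ((marginMatrix X Y).mulVec π)

/-- `V_π = diag(π) - π π'`. -/
def freqCov (π : Household X Y → ℝ) : Matrix (Household X Y) (Household X Y) ℝ :=
  Matrix.diagonal π - Matrix.vecMulVec π π

/-- `V_θ = I₁₁⁻¹ + I₁₁⁻¹ I₁₂ A V_π A' I₁₂' I₁₁⁻¹`. -/
noncomputable def thetaCov (M : EuclideanSpace ℝ (Fin d) → X → Y → ℝ → ℝ → ℝ)
    (θ : EuclideanSpace ℝ (Fin d)) (π : Household X Y → ℝ) : Matrix (Fin d) (Fin d) ℝ :=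
  (info11 M θ π)⁻¹ + (info11 M θ π)⁻¹ * info12 M θ π * marginMatrix X Y * freqCov π *
    (marginMatrix X Y).transpose * (info12 M θ π).transpose * (info11 M θ π)⁻¹

end Model

end MatchingMLE

namespace Household

/-! Write `L` and `Z` for the Jacobians of `log Π` in `θ` and `ζ` at `(θ₀, Aπ)`. An interior maximum
likelihood estimate from frequencies `p` is a zero of the score `T(p, θ) = ∑ p_h D_θ log Π_h(θ, A
p)`, and `T(π, θ₀) = 0`. Since `Π` always sums to one, the information identity replaces the second
derivatives of `log Π`, weighted by `π`, by products of first derivatives. Hence `T` has derivative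
`(δ, u) ↦ (L' - I₁₂ A) δ - I₁₁ u`, and the estimation error is `B (p - π)` up to `o(‖p - π‖)`, with
`B = I₁₁⁻¹ (L' - I₁₂ A)` (`influence`, `eventually_norm_isMLE_sub_le`).

This needs two inputs. Smoothness of `Π` comes from the implicit function theorem
(`contDiffAt_eqSingles`): monotone matching functions make the accounting system injective, and its
Jacobian too, by one sign argument (`eq_zero_of_margins_eq_zero`). Consistency
(`eventually_isMLE_mem`) holds because the divergence of `Π(θ, A p)` from `p` at a maximizer is at
most its value at `θ₀`, which is small for `p` near `π`; the divergence bounds the Hellinger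
distance, so `Π(θ, A p)` is near `π` and identification applies.

The covariance `B V_π B'` splits into the two terms of `V_θ` because the cross term vanishes
(`influence_mul_freqCov_mul_transpose`). The margins `A Π(θ, ζ)` are proportional to `ζ` for every
`θ`, so the columns of `A diag(π) L` are multiples of `ζ = Aπ`; homogeneity makes `Π` invariant
under scaling of `ζ`, so `Z ζ = 0` and `I₁₂ ζ = 0`.

Finally, the central limit theorem applies to `√N (p - π)`, Chebyshev's inequality makes the
linearization error negligible in probability, and Slutsky's theorem concludes. -/

theorem sum_eq {X Y R : Type*} [Fintype X] [Fintype Y] [AddCommMonoid R]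
    (f : Household X Y → R) :
    ∑ h, f h = ∑ x, ∑ y, f (couple x y) + (∑ x, f (man x) + ∑ y, f (woman y)) := by
  rw [← Equiv.sum_comp (equivSum X Y).symm f, Fintype.sum_sum_type, Fintype.sum_sum_type,
    Fintype.sum_prod_type]
  rfl

end Household

namespace MatchingMLE

/-! ### Existence, uniqueness and scaling of equilibria -/

section Equilibrium

variable {X Y : Type*} [Fintype X] [Fintype Y]

/-- One half of the sign argument behind uniqueness of equilibria. -/
theorem margins_sign {δ : X ⊕ Y → ℝ} {Δ : X → Y → ℝ}
    (hpos : ∀ x y, 0 ≤ δ (.inl x) → 0 ≤ δ (.inr y) → 0 ≤ Δ x y)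
    (hneg : ∀ x y, δ (.inl x) ≤ 0 → δ (.inr y) ≤ 0 → Δ x y ≤ 0)
    (hx : ∀ x, δ (.inl x) + ∑ y, Δ x y = 0) (hy : ∀ y, δ (.inr y) + ∑ x, Δ x y = 0) :
    (∀ x, δ (.inl x) ≤ 0) ∧ ∀ y, 0 ≤ δ (.inr y) := by
  classical
  -- Weight the equations of men with `δ ≥ 0` by `1` and those of women with `δ < 0` by `-1`. Every
  -- term of the weighted sum is then nonnegative, so each one vanishes.
  set a : X → ℝ := fun x => if 0 ≤ δ (.inl x) then 1 else 0 with ha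
  set b : Y → ℝ := fun y => if δ (.inr y) < 0 then 1 else 0 with hb
  have hδa : ∀ x, 0 ≤ a x * δ (.inl x) := fun x => by
    simp only [ha]; split_ifs with h <;> simp [h]
  have hδb : ∀ y, 0 ≤ -(b y * δ (.inr y)) := fun y => by
    simp only [hb]; split_ifs with h
    · simpa using h.le
    · simp
  have hΔ : ∀ x y, 0 ≤ (a x - b y) * Δ x y := fun x y => by
    simp only [ha, hb]
    split_ifs with h1 h2 h2
    · simp
    · simpa using hpos x y h1 (not_lt.1 h2)
    · simpa using hneg x y (not_le.1 h1).le h2.le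
    · simp
  have hsum : ∑ x, a x * δ (.inl x) + ∑ y, -(b y * δ (.inr y)) +
      ∑ x, ∑ y, (a x - b y) * Δ x y = 0 := by
    have h1 : ∑ x, a x * (δ (.inl x) + ∑ y, Δ x y) = 0 := by simp [hx]
    have h2 : ∑ y, b y * (δ (.inr y) + ∑ x, Δ x y) = 0 := by simp [hy]
    simp only [mul_add, Finset.sum_add_distrib, Finset.mul_sum] at h1 h2
    simp only [sub_mul, Finset.sum_sub_distrib, Finset.sum_neg_distrib]
    rw [Finset.sum_comm (f := fun y x => b y * Δ x y)] at h2
    linarith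
  have s1 : 0 ≤ ∑ x, a x * δ (.inl x) := Finset.sum_nonneg fun x _ => hδa x
  have s2 : 0 ≤ ∑ y, -(b y * δ (.inr y)) := Finset.sum_nonneg fun y _ => hδb y
  have s3 : 0 ≤ ∑ x, ∑ y, (a x - b y) * Δ x y :=
    Finset.sum_nonneg fun x _ => Finset.sum_nonneg fun y _ => hΔ x y
  constructor
  · intro x
    have h0 := (Finset.sum_eq_zero_iff_of_nonneg fun x _ => hδa x).1
      (by linarith : ∑ x, a x * δ (.inl x) = 0) x (Finset.mem_univ x)
    by_contra h
    push Not at h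
    simp [ha, h.le] at h0
    linarith
  · intro y
    have h0 := (Finset.sum_eq_zero_iff_of_nonneg fun y _ => hδb y).1
      (by linarith : ∑ y, -(b y * δ (.inr y)) = 0) y (Finset.mem_univ y)
    by_contra h
    push Not at h
    simp [hb, h] at h0
    linarith

/-- The hypotheses are symmetric under `(δ, Δ) ↦ (-δ, -Δ)`, so `margins_sign` gives both signs. It
serves twice: for the difference of two equilibria, and for the kernel of the Jacobian of the
accounting system. -/
theorem eq_zero_of_margins_eq_zero {δ : X ⊕ Y → ℝ} {Δ : X → Y → ℝ}
    (hpos : ∀ x y, 0 ≤ δ (.inl x) → 0 ≤ δ (.inr y) → 0 ≤ Δ x y)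
    (hneg : ∀ x y, δ (.inl x) ≤ 0 → δ (.inr y) ≤ 0 → Δ x y ≤ 0)
    (hx : ∀ x, δ (.inl x) + ∑ y, Δ x y = 0) (hy : ∀ y, δ (.inr y) + ∑ x, Δ x y = 0) :
    δ = 0 := by
  obtain ⟨h1, h2⟩ := margins_sign hpos hneg hx hy
  obtain ⟨h3, h4⟩ := margins_sign (δ := -δ) (Δ := fun x y => -Δ x y)
    (fun x y h h' => by
      have := hneg x y (by simpa using h) (by simpa using h'); linarith)
    (fun x y h h' => by
      have := hpos x y (by simpa using h) (by simpa using h'); linarith)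
    (fun x => by simp only [Pi.neg_apply, Finset.sum_neg_distrib]; linarith [hx x])
    (fun y => by simp only [Pi.neg_apply, Finset.sum_neg_distrib]; linarith [hy y])
  funext z
  rcases z with x | y
  · exact le_antisymm (h1 x) (neg_nonpos.1 (h3 x))
  · exact le_antisymm (neg_nonneg.1 (h4 y)) (h2 y)

theorem exists_eq_of_tendsto_zero {φ : ℝ → ℝ} (hc : ContinuousOn φ (Set.Ioi 0))
    (h0 : Tendsto φ (𝓝[>] 0) (𝓝 0)) (hge : ∀ t, 0 < t → t ≤ φ t) {c : ℝ} (hpos : 0 < c) :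
    ∃ t, 0 < t ∧ t ≤ c ∧ φ t = c := by
  have h1 : ∀ᶠ t in 𝓝[>] (0 : ℝ), φ t < c ∧ 0 < t ∧ t < c :=
    (h0.eventually (gt_mem_nhds hpos)).and (Ioo_mem_nhdsGT hpos)
  obtain ⟨a, ha, ha0, hac⟩ := h1.exists
  obtain ⟨t, ht, hφ⟩ := intermediate_value_Icc hac.le
    (hc.mono fun t ht => lt_of_lt_of_le ha0 ht.1) ⟨ha.le, hge c hpos⟩
  exact ⟨t, ha0.trans_le ht.1, ht.2, hφ⟩

/-- The mass of singles which clears one margin, given the masses of singles on the other side. -/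
theorem exists_clearing {J : Type*} [Fintype J] {f : J → ℝ → ℝ → ℝ}
    (hf : ∀ j, IsMatchingFunction (f j)) {s : J → ℝ} (hs : ∀ j, 0 < s j) {c : ℝ} (hc : 0 < c) :
    ∃ t, 0 < t ∧ t ≤ c ∧ t + ∑ j, f j t (s j) = c := by
  refine exists_eq_of_tendsto_zero (φ := fun t => t + ∑ j, f j t (s j)) ?_ ?_ ?_ hc
  · refine continuousOn_id.add (continuousOn_finsetSum _ fun j _ => ?_)
    exact (hf j).continuousOn.comp (f := fun t => (t, s j)) (by fun_prop) fun t ht => ⟨ht, hs j⟩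
  · have : Tendsto (fun t : ℝ => t + ∑ j, f j t (s j)) (𝓝[>] 0) (𝓝 (0 + ∑ _j : J, (0 : ℝ))) :=
      (tendsto_nhdsWithin_of_tendsto_nhds tendsto_id).add
        (tendsto_finsetSum _ fun j _ => (hf j).tendsto_left _ (hs j))
    simpa using this
  · intro t ht
    have := Finset.sum_nonneg fun j (_ : j ∈ Finset.univ) => ((hf j).pos t (s j) ht (hs j)).le
    linarith

/-- If more singles on the other side came with a strictly larger `t'`, no match count would fall
and the margin would exceed `c`. -/
theorem clearing_antitone {J : Type*} [Fintype J] {f : J → ℝ → ℝ → ℝ}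
    (hf : ∀ j, IsMatchingFunction (f j)) {s s' : J → ℝ} (hs : ∀ j, 0 < s j)
    (hss : ∀ j, s j ≤ s' j) {c t t' : ℝ} (ht : 0 < t)
    (h : t + ∑ j, f j t (s j) = c) (h' : t' + ∑ j, f j t' (s' j) = c) : t' ≤ t := by
  by_contra hlt
  push Not at hlt
  have : ∑ j, f j t (s j) ≤ ∑ j, f j t' (s' j) :=
    Finset.sum_le_sum fun j _ => (hf j).isotone _ _ _ _ ht (hs j) hlt.le (hss j)
  linarith

theorem IsMatchingFunction.swap {f : ℝ → ℝ → ℝ} (hf : IsMatchingFunction f) :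
    IsMatchingFunction (fun a b => f b a) where
  pos a b ha hb := hf.pos b a hb ha
  continuousOn := hf.continuousOn.comp (f := Prod.swap) continuous_swap.continuousOn
    fun _ hp => ⟨hp.2, hp.1⟩
  isotone a a' b b' ha hb h h' := hf.isotone b b' a a' hb ha h' h
  tendsto_right := hf.tendsto_left
  tendsto_left := hf.tendsto_right

/-- Each side's clearing map is antitone in the other side's singles, so their composition is
monotone, and Knaster–Tarski on a box gives a fixed point. -/
theorem exists_accounting {M : X → Y → ℝ → ℝ → ℝ} (hM : ∀ x y, IsMatchingFunction (M x y))
    {n : X → ℝ} {m : Y → ℝ} (hn : ∀ x, 0 < n x) (hm : ∀ y, 0 < m y) :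
    ∃ (s : X → ℝ) (t : Y → ℝ), (∀ x, 0 < s x) ∧ (∀ y, 0 < t y) ∧
      (∀ x, s x + ∑ y, M x y (s x) (t y) = n x) ∧ ∀ y, t y + ∑ x, M x y (s x) (t y) = m y := by
  -- Stated for all `t`, with junk value `0` off the positive orthant, so that `choose` yields a
  -- total function.
  have hF : ∀ (t : Y → ℝ) (x : X), ∃ r, (∀ y, 0 < t y) →
      0 < r ∧ r ≤ n x ∧ r + ∑ y, M x y r (t y) = n x := fun t x => by
    by_cases ht : ∀ y, 0 < t y
    · obtain ⟨r, hr⟩ := exists_clearing (fun y => hM x y) ht (hn x)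
      exact ⟨r, fun _ => hr⟩
    · exact ⟨0, fun h => absurd h ht⟩
  have hG : ∀ (s : X → ℝ) (y : Y), ∃ r, (∀ x, 0 < s x) →
      0 < r ∧ r ≤ m y ∧ r + ∑ x, M x y (s x) r = m y := fun s y => by
    by_cases hs : ∀ x, 0 < s x
    · obtain ⟨r, hr⟩ := exists_clearing (fun x => (hM x y).swap) hs (hm y)
      exact ⟨r, fun _ => hr⟩
    · exact ⟨0, fun h => absurd h hs⟩
  choose F hF using hF
  choose G hG using hG
  have hFanti : ∀ t t' : Y → ℝ, (∀ y, 0 < t y) → (∀ y, t y ≤ t' y) → ∀ x, F t' x ≤ F t x :=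
    fun t t' ht htt x =>
      clearing_antitone (fun y => hM x y) ht htt (hF t x ht).1 (hF t x ht).2.2
        (hF t' x fun y => (ht y).trans_le (htt y)).2.2
  have hGanti : ∀ s s' : X → ℝ, (∀ x, 0 < s x) → (∀ x, s x ≤ s' x) → ∀ y, G s' y ≤ G s y :=
    fun s s' hs hss y =>
      clearing_antitone (fun x => (hM x y).swap) hs hss (hG s y hs).1 (hG s y hs).2.2
        (hG s' y fun x => (hs x).trans_le (hss x)).2.2
  -- The box `∏ [G n y, m y]` is stable: `F ≤ n` and `G` is antitone, so `G (F t) ≥ G n`. Its lower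
  -- corner is positive, which keeps `F` and `G` off their junk values; the `Fact` makes each
  -- interval a complete lattice.
  have hle : ∀ y, G n y ≤ m y := fun y => (hG n y hn).2.1
  have : ∀ y, Fact (G n y ≤ m y) := fun y => ⟨hle y⟩
  have hboxpos : ∀ t : ∀ y, Set.Icc (G n y) (m y), ∀ y, 0 < (t y : ℝ) :=
    fun t y => (hG n y hn).1.trans_le (t y).2.1
  have hFpos : ∀ t : ∀ y, Set.Icc (G n y) (m y), ∀ x, 0 < F (fun y => t y) x :=
    fun t x => (hF _ x (hboxpos t)).1
  let Φ : (∀ y, Set.Icc (G n y) (m y)) →o (∀ y, Set.Icc (G n y) (m y)) :=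
    { toFun := fun t y => ⟨G (F fun y => t y) y,
        hGanti _ _ (hFpos t) (fun x => (hF _ x (hboxpos t)).2.1) y, (hG _ y (hFpos t)).2.1⟩
      monotone' := fun t t' htt y =>
        hGanti _ _ (hFpos t') (hFanti _ _ (hboxpos t) fun y => htt y) y }
  have hfix := Φ.map_lfp
  set t := OrderHom.lfp Φ
  have hty : ∀ y, G (F fun y => (t y : ℝ)) y = t y := fun y =>
    congrArg Subtype.val (congrFun hfix y)
  refine ⟨F fun y => t y, fun y => t y, hFpos t, hboxpos t, fun x => (hF _ x (hboxpos t)).2.2,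
    fun y => ?_⟩
  have := (hG _ y (hFpos t)).2.2
  rwa [hty y] at this

variable [DecidableEq X] [DecidableEq Y]

theorem marginMatrix_mulVec_inl (p : Household X Y → ℝ) (x : X) :
    (marginMatrix X Y).mulVec p (.inl x) = p (.man x) + ∑ y, p (.couple x y) := by
  simp only [Matrix.mulVec, dotProduct, Household.sum_eq, marginMatrix, ite_mul, one_mul, zero_mul]
  rw [Finset.sum_comm]
  simp [add_comm]

theorem marginMatrix_mulVec_inr (p : Household X Y → ℝ) (y : Y) :
    (marginMatrix X Y).mulVec p (.inr y) = p (.woman y) + ∑ x, p (.couple x y) := by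
  simp [Matrix.mulVec, dotProduct, Household.sum_eq, marginMatrix, add_comm]

theorem marginMatrix_mulVec_pos {p : Household X Y → ℝ} (hp : ∀ h, 0 < p h) (z : X ⊕ Y) :
    0 < (marginMatrix X Y).mulVec p z := by
  rcases z with x | y
  · rw [marginMatrix_mulVec_inl]
    exact add_pos_of_pos_of_nonneg (hp _) (Finset.sum_nonneg fun _ _ => (hp _).le)
  · rw [marginMatrix_mulVec_inr]
    exact add_pos_of_pos_of_nonneg (hp _) (Finset.sum_nonneg fun _ _ => (hp _).le)

theorem exists_isEquilibrium {M : X → Y → ℝ → ℝ → ℝ} (hM : ∀ x y, IsMatchingFunction (M x y))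
    {ζ : X ⊕ Y → ℝ} (hζ : ∀ z, 0 < ζ z) : ∃ s, IsEquilibrium M ζ s := by
  obtain ⟨s, t, hs, ht, h1, h2⟩ :=
    exists_accounting hM (fun x => hζ (.inl x)) (fun y => hζ (.inr y))
  refine ⟨Sum.elim s t, fun z => by rcases z with x | y <;> simp [hs, ht], ?_⟩
  funext z
  rcases z with x | y
  · rw [marginMatrix_mulVec_inl]; exact h1 x
  · rw [marginMatrix_mulVec_inr]; exact h2 y

theorem IsEquilibrium.unique {M : X → Y → ℝ → ℝ → ℝ} (hM : ∀ x y, IsMatchingFunction (M x y))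
    {ζ s t : X ⊕ Y → ℝ} (hs : IsEquilibrium M ζ s) (ht : IsEquilibrium M ζ t) : s = t := by
  have key := eq_zero_of_margins_eq_zero (δ := s - t)
    (Δ := fun x y => M x y (s (.inl x)) (s (.inr y)) - M x y (t (.inl x)) (t (.inr y)))
    (fun x y h h' => sub_nonneg.2 ((hM x y).isotone _ _ _ _ (ht.1 _) (ht.1 _)
      (sub_nonneg.1 h) (sub_nonneg.1 h')))
    (fun x y h h' => sub_nonpos.2 ((hM x y).isotone _ _ _ _ (hs.1 _) (hs.1 _)
      (sub_nonpos.1 h) (sub_nonpos.1 h')))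
    (fun x => ?_) (fun y => ?_)
  · exact sub_eq_zero.1 key
  · have h := congrFun (hs.2.trans ht.2.symm) (.inl x)
    simp only [marginMatrix_mulVec_inl, householdMass] at h
    simp only [Pi.sub_apply, Finset.sum_sub_distrib]
    linarith
  · have h := congrFun (hs.2.trans ht.2.symm) (.inr y)
    simp only [marginMatrix_mulVec_inr, householdMass] at h
    simp only [Pi.sub_apply, Finset.sum_sub_distrib]
    linarith

theorem isEquilibrium_eqSingles {M : X → Y → ℝ → ℝ → ℝ}
    (hM : ∀ x y, IsMatchingFunction (M x y)) {ζ : X ⊕ Y → ℝ} (hζ : ∀ z, 0 < ζ z) :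
    IsEquilibrium M ζ (eqSingles M ζ) := by
  have h := exists_isEquilibrium hM hζ
  rw [eqSingles, dif_pos h]
  exact h.choose_spec

theorem IsEquilibrium.eqSingles_eq {M : X → Y → ℝ → ℝ → ℝ}
    (hM : ∀ x y, IsMatchingFunction (M x y)) {ζ s : X ⊕ Y → ℝ} (hs : IsEquilibrium M ζ s) :
    eqSingles M ζ = s := by
  have h : ∃ s, IsEquilibrium M ζ s := ⟨s, hs⟩
  rw [eqSingles, dif_pos h]
  exact IsEquilibrium.unique hM h.choose_spec hs

omit [Fintype X] [Fintype Y] [DecidableEq X] [DecidableEq Y] in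
theorem householdMass_pos {M : X → Y → ℝ → ℝ → ℝ} (hM : ∀ x y, IsMatchingFunction (M x y))
    {s : X ⊕ Y → ℝ} (hs : ∀ z, 0 < s z) (h : Household X Y) : 0 < householdMass M s h := by
  cases h with
  | couple x y => exact (hM x y).pos _ _ (hs _) (hs _)
  | man x => exact hs _
  | woman y => exact hs _

omit [DecidableEq X] [DecidableEq Y] in
theorem sum_householdMass_pos [Nonempty (Household X Y)] {M : X → Y → ℝ → ℝ → ℝ}
    (hM : ∀ x y, IsMatchingFunction (M x y)) {s : X ⊕ Y → ℝ} (hs : ∀ z, 0 < s z) :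
    0 < ∑ h, householdMass M s h :=
  Finset.sum_pos (fun h _ => householdMass_pos hM hs h) Finset.univ_nonempty

variable {M : X → Y → ℝ → ℝ → ℝ} {ζ : X ⊕ Y → ℝ}

theorem predFreq_pos [Nonempty (Household X Y)] (hM : ∀ x y, IsMatchingFunction (M x y))
    (hζ : ∀ z, 0 < ζ z) (h : Household X Y) : 0 < predFreq M ζ h :=
  div_pos (householdMass_pos hM (isEquilibrium_eqSingles hM hζ).1 h)
    (sum_householdMass_pos hM (isEquilibrium_eqSingles hM hζ).1)

theorem sum_predFreq [Nonempty (Household X Y)] (hM : ∀ x y, IsMatchingFunction (M x y))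
    (hζ : ∀ z, 0 < ζ z) : ∑ h, predFreq M ζ h = 1 := by
  simp only [predFreq, ← Finset.sum_div]
  exact div_self (sum_householdMass_pos hM (isEquilibrium_eqSingles hM hζ).1).ne'

/-- The equilibrium clears the margins exactly, so dividing by the number of households only
rescales them. The direction does not depend on the matching functions, which later kills the cross
term of the covariance. -/
theorem marginMatrix_mulVec_predFreq (hM : ∀ x y, IsMatchingFunction (M x y))
    (hζ : ∀ z, 0 < ζ z) : (marginMatrix X Y).mulVec (predFreq M ζ) =
      (∑ h, householdMass M (eqSingles M ζ) h)⁻¹ • ζ := by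
  have : predFreq M ζ = (∑ h, householdMass M (eqSingles M ζ) h)⁻¹ •
      householdMass M (eqSingles M ζ) := by
    funext h; simp [predFreq, div_eq_inv_mul]
  rw [this, Matrix.mulVec_smul, (isEquilibrium_eqSingles hM hζ).2]

omit [Fintype X] [Fintype Y] [DecidableEq X] [DecidableEq Y] in
theorem householdMass_smul (hhom : ∀ x y, IsHomogeneousOne (M x y)) {s : X ⊕ Y → ℝ}
    (hs : ∀ z, 0 < s z) {c : ℝ} (hc : 0 < c) :
    householdMass M (c • s) = c • householdMass M s := by
  funext h
  cases h with
  | couple x y => exact hhom x y _ _ _ hc (hs _) (hs _)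
  | man x => rfl
  | woman y => rfl

theorem eqSingles_smul (hM : ∀ x y, IsMatchingFunction (M x y))
    (hhom : ∀ x y, IsHomogeneousOne (M x y)) (hζ : ∀ z, 0 < ζ z) {c : ℝ} (hc : 0 < c) :
    eqSingles M (c • ζ) = c • eqSingles M ζ := by
  have h := isEquilibrium_eqSingles hM hζ
  refine IsEquilibrium.eqSingles_eq hM ⟨fun z => mul_pos hc (h.1 z), ?_⟩
  rw [householdMass_smul hhom h.1 hc, Matrix.mulVec_smul, h.2]

theorem predFreq_smul (hM : ∀ x y, IsMatchingFunction (M x y))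
    (hhom : ∀ x y, IsHomogeneousOne (M x y)) (hζ : ∀ z, 0 < ζ z) {c : ℝ} (hc : 0 < c) :
    predFreq M (c • ζ) = predFreq M ζ := by
  have h := isEquilibrium_eqSingles hM hζ
  funext k
  simp only [predFreq]
  rw [eqSingles_smul hM hhom hζ hc, householdMass_smul hhom h.1 hc]
  simp only [Pi.smul_apply, smul_eq_mul, ← Finset.mul_sum]
  exact mul_div_mul_left _ _ hc.ne'

theorem predFreq_mulVec_predFreq [Nonempty (Household X Y)]
    (hM : ∀ x y, IsMatchingFunction (M x y))
    (hhom : ∀ x y, IsHomogeneousOne (M x y)) (hζ : ∀ z, 0 < ζ z) :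
    predFreq M ((marginMatrix X Y).mulVec (predFreq M ζ)) = predFreq M ζ := by
  rw [marginMatrix_mulVec_predFreq hM hζ]
  exact predFreq_smul hM hhom hζ
    (inv_pos.2 (sum_householdMass_pos hM (isEquilibrium_eqSingles hM hζ).1))

end Equilibrium

/-! ### Smooth dependence of the equilibrium on the parameter and the margins -/

section Smoothness

/-- The point `p` minimizes `g` on the orthant above it, and `v` lies in the tangent cone there. -/
theorem hasFDerivAt_nonneg_of_isotone {g : ℝ × ℝ → ℝ} {g' : ℝ × ℝ →L[ℝ] ℝ} {p v : ℝ × ℝ}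
    (hg : HasFDerivAt g g' p) (hmono : ∀ q, p ≤ q → g p ≤ g q) (hv : 0 ≤ v) : 0 ≤ g' v := by
  have hmin : IsLocalMinOn g (Set.Ici p) p :=
    eventually_nhdsWithin_of_forall fun q hq => hmono q hq
  refine hmin.hasFDerivWithinAt_nonneg hg.hasFDerivWithinAt
    (mem_posTangentConeAt_of_segment_subset ?_)
  exact (convex_Ici p).segment_subset Set.self_mem_Ici (le_add_of_nonneg_right hv)

variable {X Y : Type*} [Fintype X] [Fintype Y] [DecidableEq X] [DecidableEq Y]
variable {E : Type*} [NormedAddCommGroup E] [NormedSpace ℝ E]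
variable {M : E → X → Y → ℝ → ℝ → ℝ} {Θ : Set E} {θ₀ : E}

omit [DecidableEq X] [DecidableEq Y] in
theorem contDiffAt_householdMass
    (hsmooth : ∀ x y, ContDiffOn ℝ 2 (fun p : E × ℝ × ℝ => M p.1 x y p.2.1 p.2.2)
      (interior Θ ×ˢ (Set.Ioi 0 ×ˢ Set.Ioi 0)))
    (hθ₀ : θ₀ ∈ interior Θ) {s₀ : X ⊕ Y → ℝ} (hs₀ : ∀ z, 0 < s₀ z) (h : Household X Y) :
    ContDiffAt ℝ 2 (fun q : E × (X ⊕ Y → ℝ) => householdMass (M q.1) q.2 h) (θ₀, s₀) := by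
  have hproj : ∀ z, ContDiffAt ℝ 2 (fun q : E × (X ⊕ Y → ℝ) => q.2 z) (θ₀, s₀) := fun z => by
    fun_prop
  cases h with
  | couple x y =>
    have h1 : ContDiffAt ℝ 2 (fun p : E × ℝ × ℝ => M p.1 x y p.2.1 p.2.2)
        (θ₀, s₀ (.inl x), s₀ (.inr y)) :=
      (hsmooth x y).contDiffAt ((isOpen_interior.prod (isOpen_Ioi.prod isOpen_Ioi)).mem_nhds
        ⟨hθ₀, hs₀ _, hs₀ _⟩)
    exact h1.comp (θ₀, s₀) (f := fun q : E × (X ⊕ Y → ℝ) => (q.1, q.2 (.inl x), q.2 (.inr y)))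
      (contDiffAt_fst.prodMk ((hproj _).prodMk (hproj _)))
  | man x => exact hproj _
  | woman y => exact hproj _

omit [NormedAddCommGroup E] [NormedSpace ℝ E] in
/-- The Jacobian of the accounting system in the masses of singles is injective. -/
theorem accounting_fderiv_injective
    (hM : ∀ x y, IsMatchingFunction (M θ₀ x y)) {s₀ : X ⊕ Y → ℝ} (hs₀ : ∀ z, 0 < s₀ z)
    (hd : ∀ x y, DifferentiableAt ℝ (fun p : ℝ × ℝ => M θ₀ x y p.1 p.2)
      (s₀ (.inl x), s₀ (.inr y)))
    {L : (X ⊕ Y → ℝ) →L[ℝ] (X ⊕ Y → ℝ)}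
    (hL : HasFDerivAt (fun s => (marginMatrix X Y).mulVec (householdMass (M θ₀) s)) L s₀) :
    Function.Injective L := by
  refine (injective_iff_map_eq_zero L).2 fun δ hδ => ?_
  set D : X → Y → ℝ × ℝ →L[ℝ] ℝ := fun x y =>
    fderiv ℝ (fun p : ℝ × ℝ => M θ₀ x y p.1 p.2) (s₀ (.inl x), s₀ (.inr y)) with hD
  have hnonneg : ∀ x y v, 0 ≤ v → 0 ≤ D x y v := fun x y v hv =>
    hasFDerivAt_nonneg_of_isotone (hd x y).hasFDerivAt
      (fun q hq => (hM x y).isotone _ _ _ _ (hs₀ _) (hs₀ _) hq.1 hq.2) hv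
  have hpr : ∀ z, HasFDerivAt (fun s : X ⊕ Y → ℝ => s z)
      (ContinuousLinearMap.proj (R := ℝ) (φ := fun _ : X ⊕ Y => ℝ) z) s₀ :=
    fun z => hasFDerivAt_apply z s₀
  have hM' : ∀ x y, HasFDerivAt
      (fun s : X ⊕ Y → ℝ => M θ₀ x y (s (.inl x)) (s (.inr y)))
      ((D x y).comp ((ContinuousLinearMap.proj (R := ℝ) (φ := fun _ : X ⊕ Y => ℝ) (.inl x)).prod
        (ContinuousLinearMap.proj (R := ℝ) (φ := fun _ : X ⊕ Y => ℝ) (.inr y)))) s₀ := fun x y =>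
    HasFDerivAt.comp (g := fun p : ℝ × ℝ => M θ₀ x y p.1 p.2) s₀ (hd x y).hasFDerivAt
      ((hpr _).prodMk (hpr _))
  -- A kernel vector of the Jacobian solves the linearized accounting system with zero margins.
  -- Monotonicity gives `D x y` the sign pattern required of `Δ`.
  refine eq_zero_of_margins_eq_zero (Δ := fun x y => D x y (δ (.inl x), δ (.inr y)))
    (fun x y h h' => hnonneg x y _ ⟨h, h'⟩) (fun x y h h' => ?_) (fun x => ?_) fun y => ?_
  · have := hnonneg x y (-(δ (.inl x), δ (.inr y))) ⟨neg_nonneg.2 h, neg_nonneg.2 h'⟩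
    rw [map_neg] at this
    linarith
  · have h1 := (hasFDerivAt_pi'.1 hL) (.inl x)
    have h2 := (hpr (.inl x)).add (HasFDerivAt.fun_sum (u := Finset.univ) fun y _ => hM' x y)
    have h3 := DFunLike.congr_fun (h1.unique (h2.congr_of_eventuallyEq
      (Eventually.of_forall fun s => marginMatrix_mulVec_inl _ x))) δ
    simpa [hδ] using h3.symm
  · have h1 := (hasFDerivAt_pi'.1 hL) (.inr y)
    have h2 := (hpr (.inr y)).add (HasFDerivAt.fun_sum (u := Finset.univ) fun x _ => hM' x y)
    have h3 := DFunLike.congr_fun (h1.unique (h2.congr_of_eventuallyEq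
      (Eventually.of_forall fun s => marginMatrix_mulVec_inr _ y))) δ
    simpa [hδ] using h3.symm

variable [CompleteSpace E]

theorem isInvertible_of_injective {V : Type*} [NormedAddCommGroup V] [NormedSpace ℝ V]
    [FiniteDimensional ℝ V] {L : V →L[ℝ] V} (hL : Function.Injective L) : L.IsInvertible :=
  ⟨(LinearEquiv.ofInjectiveEndo (L : V →ₗ[ℝ] V) hL).toContinuousLinearEquiv, by ext v; rfl⟩

/-- The implicit function theorem gives a `C²` branch of solutions. Near the base point the branch
is positive, so uniqueness of equilibria identifies it with `eqSingles`. -/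
theorem contDiffAt_eqSingles (hM : ∀ θ ∈ Θ, ∀ x y, IsMatchingFunction (M θ x y))
    (hsmooth : ∀ x y, ContDiffOn ℝ 2 (fun p : E × ℝ × ℝ => M p.1 x y p.2.1 p.2.2)
      (interior Θ ×ˢ (Set.Ioi 0 ×ˢ Set.Ioi 0)))
    (hθ₀ : θ₀ ∈ interior Θ) {ζ₀ : X ⊕ Y → ℝ} (hζ₀ : ∀ z, 0 < ζ₀ z) :
    ContDiffAt ℝ 2 (fun q : E × (X ⊕ Y → ℝ) => eqSingles (M q.1) q.2) (θ₀, ζ₀) := by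
  have hM₀ := hM θ₀ (interior_subset hθ₀)
  have heq := isEquilibrium_eqSingles hM₀ hζ₀
  set s₀ := eqSingles (M θ₀) ζ₀ with hs₀
  let f : (E × (X ⊕ Y → ℝ)) × (X ⊕ Y → ℝ) → (X ⊕ Y → ℝ) := fun u =>
    (marginMatrix X Y).mulVec (householdMass (M u.1.1) u.2) - u.1.2
  have hmass : ContDiffAt ℝ 2
      (fun q : E × (X ⊕ Y → ℝ) => (marginMatrix X Y).mulVec (householdMass (M q.1) q.2))
      (θ₀, s₀) := by
    refine contDiffAt_pi.2 fun z => ?_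
    simp only [Matrix.mulVec, dotProduct]
    exact ContDiffAt.sum fun h _ =>
      contDiffAt_const.mul (contDiffAt_householdMass hsmooth hθ₀ heq.1 h)
  have hf : ContDiffAt ℝ 2 f ((θ₀, ζ₀), s₀) := by
    refine ContDiffAt.sub ?_ (by fun_prop)
    exact hmass.comp ((θ₀, ζ₀), s₀)
      (f := fun u : (E × (X ⊕ Y → ℝ)) × (X ⊕ Y → ℝ) => (u.1.1, u.2)) (by fun_prop)
  have hd : ∀ x y, DifferentiableAt ℝ (fun p : ℝ × ℝ => M θ₀ x y p.1 p.2)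
      (s₀ (.inl x), s₀ (.inr y)) := fun x y => by
    have h1 : ContDiffAt ℝ 2 (fun p : E × ℝ × ℝ => M p.1 x y p.2.1 p.2.2)
        (θ₀, s₀ (.inl x), s₀ (.inr y)) :=
      (hsmooth x y).contDiffAt ((isOpen_interior.prod (isOpen_Ioi.prod isOpen_Ioi)).mem_nhds
        ⟨hθ₀, heq.1 _, heq.1 _⟩)
    exact (h1.differentiableAt (by norm_num)).comp (s₀ (.inl x), s₀ (.inr y))
      (f := fun p : ℝ × ℝ => (θ₀, p)) (by fun_prop)
  have hinv : (fderiv ℝ f ((θ₀, ζ₀), s₀) ∘L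
      ContinuousLinearMap.inr ℝ (E × (X ⊕ Y → ℝ)) (X ⊕ Y → ℝ)).IsInvertible := by
    apply isInvertible_of_injective
    refine accounting_fderiv_injective hM₀ heq.1 hd ?_
    have h1 := ((hf.differentiableAt (by norm_num)).hasFDerivAt.comp s₀
      (hasFDerivAt_prodMk_right (θ₀, ζ₀) s₀)).add_const ζ₀
    refine h1.congr_of_eventuallyEq (Eventually.of_forall fun s => ?_)
    simp [f]
  have h2 : (2 : WithTop ℕ∞) ≠ 0 := by norm_num
  have hcd := hf.contDiffAt_implicitFunction h2 hinv
  refine hcd.congr_of_eventuallyEq ?_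
  have hself := hf.implicitFunction_apply_self h2 hinv
  have hpos : ∀ᶠ q in 𝓝 (θ₀, ζ₀), ∀ z, 0 < hf.implicitFunction h2 hinv q z := by
    refine eventually_all.2 fun z => ?_
    have hc : ContinuousAt (fun q => hf.implicitFunction h2 hinv q z) (θ₀, ζ₀) :=
      (continuous_apply z).continuousAt.comp hcd.continuousAt
    exact hc.eventually (lt_mem_nhds ((heq.1 z).trans_eq (congrFun hself z).symm))
  have hint : ∀ᶠ q : E × (X ⊕ Y → ℝ) in 𝓝 (θ₀, ζ₀), q.1 ∈ interior Θ :=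
    continuousAt_fst.eventually (isOpen_interior.mem_nhds hθ₀)
  filter_upwards [hpos, hint, hf.eventually_apply_implicitFunction h2 hinv] with q h1 h3 h4
  refine IsEquilibrium.eqSingles_eq (hM _ (interior_subset h3)) ⟨h1, ?_⟩
  have h5 : f ((θ₀, ζ₀), s₀) = 0 := sub_eq_zero.2 heq.2
  rw [h5] at h4
  exact sub_eq_zero.1 h4

/-- The logarithm of a predicted frequency, as a function of the parameter and the margins. -/
noncomputable def logFreq (M : E → X → Y → ℝ → ℝ → ℝ) (h : Household X Y)
    (q : E × (X ⊕ Y → ℝ)) : ℝ :=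
  Real.log (predFreq (M q.1) q.2 h)

theorem contDiffAt_logFreq [Nonempty (Household X Y)]
    (hM : ∀ θ ∈ Θ, ∀ x y, IsMatchingFunction (M θ x y))
    (hsmooth : ∀ x y, ContDiffOn ℝ 2 (fun p : E × ℝ × ℝ => M p.1 x y p.2.1 p.2.2)
      (interior Θ ×ˢ (Set.Ioi 0 ×ˢ Set.Ioi 0)))
    (hθ₀ : θ₀ ∈ interior Θ) {ζ₀ : X ⊕ Y → ℝ} (hζ₀ : ∀ z, 0 < ζ₀ z) (h : Household X Y) :
    ContDiffAt ℝ 2 (logFreq M h) (θ₀, ζ₀) := by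
  have hM₀ := hM θ₀ (interior_subset hθ₀)
  have heq := isEquilibrium_eqSingles hM₀ hζ₀
  have hs := contDiffAt_eqSingles hM hsmooth hθ₀ hζ₀
  have hm : ∀ k, ContDiffAt ℝ 2 (fun q : E × (X ⊕ Y → ℝ) =>
      householdMass (M q.1) (eqSingles (M q.1) q.2) k) (θ₀, ζ₀) := fun k =>
    (contDiffAt_householdMass hsmooth hθ₀ heq.1 k).comp (θ₀, ζ₀)
      (f := fun q : E × (X ⊕ Y → ℝ) => (q.1, eqSingles (M q.1) q.2)) (contDiffAt_fst.prodMk hs)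
  exact ((hm h).div (ContDiffAt.sum fun k _ => hm k)
    (sum_householdMass_pos hM₀ heq.1).ne').log (predFreq_pos hM₀ hζ₀ h).ne'

end Smoothness

/-! ### The score, the information identity and asymptotic linearity -/

section Score

variable {ι F : Type*} [Fintype ι] [NormedAddCommGroup F] [NormedSpace ℝ F]
  {G : ι → F → ℝ} {q₀ : F}

/-- The score of a smooth family of probability vectors `exp (G i q)` is centred. -/
theorem eventually_sum_exp_smul_fderiv_eq_zero (hG : ∀ i, ContDiffAt ℝ 2 (G i) q₀)
    (hsum : ∀ᶠ q in 𝓝 q₀, ∑ i, Real.exp (G i q) = 1) :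
    ∀ᶠ q in 𝓝 q₀, ∑ i, Real.exp (G i q) • fderiv ℝ (G i) q = 0 := by
  filter_upwards [hsum.eventually_nhds,
    eventually_all.2 fun i => (hG i).eventually (by simp)] with q h1 h2
  have h3 : HasFDerivAt (fun q => ∑ i, Real.exp (G i q))
      (∑ i, Real.exp (G i q) • fderiv ℝ (G i) q) q :=
    HasFDerivAt.fun_sum fun i _ => ((h2 i).differentiableAt (by norm_num)).hasFDerivAt.exp
  exact h3.unique ((hasFDerivAt_const (1 : ℝ) q).congr_of_eventuallyEq h1)

/-- The information identity of a smooth family of probability vectors `exp (G i q)`. -/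
theorem sum_exp_smul_fderiv_fderiv (hG : ∀ i, ContDiffAt ℝ 2 (G i) q₀)
    (hsum : ∀ᶠ q in 𝓝 q₀, ∑ i, Real.exp (G i q) = 1) :
    ∑ i, Real.exp (G i q₀) • fderiv ℝ (fderiv ℝ (G i)) q₀ =
      -∑ i, (Real.exp (G i q₀) • fderiv ℝ (G i) q₀).smulRight (fderiv ℝ (G i) q₀) := by
  have h1 : ∀ i, HasFDerivAt (fun q => Real.exp (G i q) • fderiv ℝ (G i) q)
      (Real.exp (G i q₀) • fderiv ℝ (fderiv ℝ (G i)) q₀ +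
        (Real.exp (G i q₀) • fderiv ℝ (G i) q₀).smulRight (fderiv ℝ (G i) q₀)) q₀ := fun i =>
    (((hG i).differentiableAt (by norm_num)).hasFDerivAt.exp).smul
      (((hG i).fderiv_right (m := 1) (by norm_num)).differentiableAt (by norm_num)).hasFDerivAt
  have h2 := (HasFDerivAt.fun_sum (u := Finset.univ) fun i _ => h1 i).unique
    ((hasFDerivAt_const (0 : F →L[ℝ] ℝ) q₀).congr_of_eventuallyEq
      (eventually_sum_exp_smul_fderiv_eq_zero hG hsum))
  rw [Finset.sum_add_distrib] at h2
  exact eq_neg_of_add_eq_zero_left h2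

/-- This is the score in direction `v` with the margins tied to the frequencies through `A`. By the
information identity its derivative at the truth contains first derivatives of `G` only; the
dependence through `A δ` is the effect of estimating the margins. -/
theorem exists_hasFDerivAt_score {E Z : Type*} [NormedAddCommGroup E] [NormedSpace ℝ E]
    [NormedAddCommGroup Z] [NormedSpace ℝ Z] {G : ι → E × Z → ℝ} {θ₀ : E} {π : ι → ℝ}
    (A : (ι → ℝ) →L[ℝ] Z) (hG : ∀ i, ContDiffAt ℝ 2 (G i) (θ₀, A π))
    (hsum : ∀ᶠ q in 𝓝 (θ₀, A π), ∑ i, Real.exp (G i q) = 1)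
    (hπ : ∀ i, Real.exp (G i (θ₀, A π)) = π i) (v : E × Z) :
    ∃ S' : (ι → ℝ) × E →L[ℝ] ℝ,
      HasFDerivAt (fun r : (ι → ℝ) × E => ∑ i, r.1 i * fderiv ℝ (G i) (r.2, A r.1) v) S' (π, θ₀) ∧
      ∀ δ u, S' (δ, u) = ∑ i, δ i * fderiv ℝ (G i) (θ₀, A π) v -
        ∑ i, π i * fderiv ℝ (G i) (θ₀, A π) (u, A δ) * fderiv ℝ (G i) (θ₀, A π) v := by
  let φ : (ι → ℝ) × E →L[ℝ] E × Z :=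
    (ContinuousLinearMap.snd ℝ _ _).prod (A.comp (ContinuousLinearMap.fst ℝ _ _))
  have hD : ∀ i, HasFDerivAt (fun r : (ι → ℝ) × E => fderiv ℝ (G i) (r.2, A r.1) v)
      ((ContinuousLinearMap.apply ℝ ℝ v).comp
        ((fderiv ℝ (fderiv ℝ (G i)) (θ₀, A π)).comp φ)) (π, θ₀) := fun i => by
    have h1 := (((hG i).fderiv_right (m := 1) (by norm_num)).differentiableAt
      (by norm_num)).hasFDerivAt
    have h2 : HasFDerivAt (fun r : (ι → ℝ) × E => fderiv ℝ (G i) (φ r)) _ (π, θ₀) :=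
      HasFDerivAt.comp (g := fderiv ℝ (G i)) (π, θ₀) h1 φ.hasFDerivAt
    exact (ContinuousLinearMap.apply ℝ ℝ v).hasFDerivAt.comp (π, θ₀) h2
  have hp : ∀ i, HasFDerivAt (fun r : (ι → ℝ) × E => r.1 i)
      ((ContinuousLinearMap.proj (R := ℝ) (φ := fun _ : ι => ℝ) i).comp
        (ContinuousLinearMap.fst ℝ _ _)) (π, θ₀) := fun i =>
    ((ContinuousLinearMap.proj (R := ℝ) (φ := fun _ : ι => ℝ) i).comp
      (ContinuousLinearMap.fst ℝ (ι → ℝ) E)).hasFDerivAt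
  refine ⟨_, HasFDerivAt.fun_sum fun i _ => (hp i).mul (hD i), fun δ u => ?_⟩
  have h3 := DFunLike.congr_fun
    (DFunLike.congr_fun (sum_exp_smul_fderiv_fderiv hG hsum) (u, A δ)) v
  simp only [hπ, _root_.neg_apply, _root_.sum_apply,
    _root_.smul_apply, ContinuousLinearMap.smulRight_apply, smul_eq_mul] at h3
  simp only [_root_.sum_apply, _root_.add_apply,
    _root_.smul_apply, ContinuousLinearMap.comp_apply,
    ContinuousLinearMap.apply_apply, ContinuousLinearMap.coe_fst', smul_eq_mul,
    ContinuousLinearMap.proj_apply, Finset.sum_add_distrib, φ, ContinuousLinearMap.prod_apply,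
    ContinuousLinearMap.coe_snd']
  rw [h3]
  have : ∀ i, fderiv ℝ (G i) (θ₀, A π) v * δ i = δ i * fderiv ℝ (G i) (θ₀, A π) v :=
    fun i => mul_comm _ _
  simp only [this]
  ring

/-- Zeros of a differentiable estimating function are asymptotically linear. -/
theorem eventually_norm_zero_sub_le {V E W : Type*} [NormedAddCommGroup V] [NormedSpace ℝ V]
    [NormedAddCommGroup E] [NormedSpace ℝ E] [NormedAddCommGroup W] [NormedSpace ℝ W]
    {T : V × E → W} {T' : V × E →L[ℝ] W} {p₀ : V} {θ₀ : E} (hT : HasFDerivAt T T' (p₀, θ₀))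
    (h0 : T (p₀, θ₀) = 0) (C : V →L[ℝ] E) (J : W →L[ℝ] E)
    (hJ : ∀ δ u, J (T' (δ, u)) = C δ - u) {ε : ℝ} (hε : 0 < ε) :
    ∀ᶠ r in 𝓝 (p₀, θ₀), T r = 0 → ‖r.2 - θ₀ - C (r.1 - p₀)‖ ≤ ε * ‖r.1 - p₀‖ := by
  set K := ‖J‖ + 1 with hK
  have hK0 : 0 < K := by positivity
  -- The bound `1 / 2` lets `η ‖u - C δ‖` be absorbed on the left; the other bound makes what
  -- remains at most `ε ‖δ‖ / 2`.
  set η := min (1 / 2) (ε / (2 * (‖C‖ + 1))) with hη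
  have hη0 : 0 < η := by positivity
  filter_upwards [hT.isLittleO.bound (div_pos hη0 hK0)] with r hr hr0
  rw [hr0, h0] at hr
  set δ := r.1 - p₀
  set u := r.2 - θ₀
  have h1 : r - (p₀, θ₀) = (δ, u) := rfl
  rw [h1] at hr
  have h2 : ‖T' (δ, u)‖ ≤ η / K * (‖δ‖ + ‖u‖) := by
    have : ‖((δ, u) : V × E)‖ ≤ ‖δ‖ + ‖u‖ :=
      max_le (by simp) (by simp)
    calc ‖T' (δ, u)‖ = ‖(0 : W) - 0 - T' (δ, u)‖ := by simp
      _ ≤ η / K * ‖((δ, u) : V × E)‖ := hr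
      _ ≤ _ := by gcongr
  have h3 : ‖u - C δ‖ ≤ η * (‖δ‖ + ‖u‖) := by
    rw [norm_sub_rev, ← hJ]
    calc ‖J (T' (δ, u))‖ ≤ ‖J‖ * ‖T' (δ, u)‖ := J.le_opNorm _
      _ ≤ K * (η / K * (‖δ‖ + ‖u‖)) := by gcongr; simp [hK]
      _ = _ := by field_simp
  have h4 : ‖u‖ ≤ ‖C‖ * ‖δ‖ + ‖u - C δ‖ := by
    calc ‖u‖ = ‖C δ + (u - C δ)‖ := by simp
      _ ≤ ‖C δ‖ + ‖u - C δ‖ := norm_add_le _ _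
      _ ≤ _ := by gcongr; exact C.le_opNorm _
  have h5 : ‖u - C δ‖ ≤ η * (‖δ‖ + (‖C‖ * ‖δ‖ + ‖u - C δ‖)) := h3.trans (by gcongr)
  have h6 : η * ‖u - C δ‖ ≤ 1 / 2 * ‖u - C δ‖ := by gcongr; exact min_le_left _ _
  have h7 : η * ((‖C‖ + 1) * ‖δ‖) ≤ ε / (2 * (‖C‖ + 1)) * ((‖C‖ + 1) * ‖δ‖) := by
    gcongr; exact min_le_right _ _
  have h8 : ε / (2 * (‖C‖ + 1)) * ((‖C‖ + 1) * ‖δ‖) = ε * ‖δ‖ / 2 := by field_simp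
  nlinarith

end Score

/-! ### Hellinger distance and Kullback-Leibler divergence -/

section Divergence

/-- A bound on the squared Hellinger distance by the Kullback-Leibler divergence. -/
theorem sum_sqrt_sub_sqrt_sq_le {ι : Type*} [Fintype ι] {p q : ι → ℝ} (hp : ∀ i, 0 < p i)
    (hq : ∀ i, 0 < q i) (hp1 : ∑ i, p i = 1) (hq1 : ∑ i, q i = 1) :
    ∑ i, (√(p i) - √(q i)) ^ 2 ≤ ∑ i, p i * Real.log (p i) - ∑ i, p i * Real.log (q i) := by
  have hterm : ∀ i, (√(p i) - √(q i)) ^ 2 + p i - q i ≤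
      p i * Real.log (p i) - p i * Real.log (q i) := fun i => by
    have hsp := Real.sqrt_pos.2 (hp i)
    have hsq := Real.sqrt_pos.2 (hq i)
    -- Apply `log t ≤ t - 1` at `t = √q / √p`; multiplying by `2p` gives `p log q - p log p ≤ 2 √p
    -- √q - 2p`.
    have h1 := Real.log_le_sub_one_of_pos (div_pos hsq hsp)
    rw [Real.log_div hsq.ne' hsp.ne', Real.log_sqrt (hq i).le, Real.log_sqrt (hp i).le] at h1
    have h2 := Real.mul_self_sqrt (hp i).le
    have h3 := Real.mul_self_sqrt (hq i).le
    have h4 : p i * (√(q i) / √(p i)) = √(p i) * √(q i) := by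
      nth_rw 1 [← h2]; field_simp
    have h5 := mul_le_mul_of_nonneg_left h1 (hp i).le
    rw [mul_sub (p i) (√(q i) / √(p i)), h4] at h5
    nlinarith
  have := Finset.sum_le_sum fun i (_ : i ∈ Finset.univ) => hterm i
  simp only [Finset.sum_sub_distrib, Finset.sum_add_distrib, hp1, hq1] at this
  linarith

theorem abs_sub_le_of_sum_sqrt_sub_sqrt_sq_le {ι : Type*} [Fintype ι] {p q : ι → ℝ}
    (hp : ∀ i, 0 < p i) (hq : ∀ i, 0 < q i) (hp1 : ∑ i, p i = 1) (hq1 : ∑ i, q i = 1) {η : ℝ}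
    (hη : 0 ≤ η) (h : ∑ i, (√(p i) - √(q i)) ^ 2 ≤ η ^ 2) (i : ι) : |p i - q i| ≤ 2 * η := by
  have h1 : (√(p i) - √(q i)) ^ 2 ≤ η ^ 2 :=
    (Finset.single_le_sum (f := fun i => (√(p i) - √(q i)) ^ 2) (fun j _ => sq_nonneg _)
      (Finset.mem_univ i)).trans h
  have h2 := abs_le_of_sq_le_sq h1 hη
  have hle : ∀ {r : ι → ℝ}, (∀ i, 0 < r i) → ∑ i, r i = 1 → √(r i) ≤ 1 := fun hr hr1 =>
    Real.sqrt_le_one.2 (hr1 ▸ Finset.single_le_sum (fun j _ => (hr j).le) (Finset.mem_univ i))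
  have h3 : p i - q i = (√(p i) - √(q i)) * (√(p i) + √(q i)) := by
    nlinarith [Real.mul_self_sqrt (hp i).le, Real.mul_self_sqrt (hq i).le]
  rw [h3, abs_mul, abs_of_nonneg (by positivity : 0 ≤ √(p i) + √(q i)), mul_comm]
  have := abs_nonneg (√(p i) - √(q i))
  exact mul_le_mul (by linarith [hle hp hp1, hle hq hq1]) h2 this (by norm_num)

end Divergence

/-! ### Consistency and linearization for frequencies near the truth -/

section Deterministic

variable {X Y : Type*} [Fintype X] [Fintype Y] [DecidableEq X] [DecidableEq Y] {d : ℕ}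
  {M : EuclideanSpace ℝ (Fin d) → X → Y → ℝ → ℝ → ℝ} {Θ : Set (EuclideanSpace ℝ (Fin d))}
  {θ₀ : EuclideanSpace ℝ (Fin d)} {π : Household X Y → ℝ}

theorem continuous_marginMatrix_mulVec :
    Continuous fun p : Household X Y → ℝ => (marginMatrix X Y).mulVec p :=
  continuous_const.matrix_mulVec continuous_id

/-- Consistency: maximum likelihood estimates from frequencies close to `π` are close to `θ₀`. -/
theorem eventually_isMLE_mem [Nonempty (Household X Y)]
    (hM : ∀ θ ∈ Θ, ∀ x y, IsMatchingFunction (M θ x y)) (hθ₀ : θ₀ ∈ Θ) (hπ : ∀ h, 0 < π h)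
    (hfix : predFreq (M θ₀) ((marginMatrix X Y).mulVec π) = π)
    (hcont : ∀ h, ContinuousAt (fun ζ => Real.log (predFreq (M θ₀) ζ h))
      ((marginMatrix X Y).mulVec π))
    (hident : IsIdentified M Θ θ₀ π) {U : Set (EuclideanSpace ℝ (Fin d))} (hU : U ∈ 𝓝 θ₀) :
    ∀ᶠ p in 𝓝 π, ∑ h, p h = 1 → ∀ θ, IsMLE M Θ p θ → θ ∈ U := by
  obtain ⟨V, hV, W, hW, hVW⟩ := hident U hU
  obtain ⟨ε, hε, hball⟩ := Metric.mem_nhds_iff.1 hW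
  have hA : ContinuousAt (fun p : Household X Y → ℝ => (marginMatrix X Y).mulVec p) π :=
    continuous_marginMatrix_mulVec.continuousAt
  -- The divergence of `Π(θ₀, A p)` from `p`: continuous at `π`, where it vanishes. It bounds the
  -- divergence at any maximizer.
  let Φ : (Household X Y → ℝ) → ℝ := fun p =>
    ∑ h, p h * Real.log (p h) - logLik M p θ₀ ((marginMatrix X Y).mulVec p)
  have hap : ∀ h, ContinuousAt (fun p : Household X Y → ℝ => p h) π :=
    fun h => (continuous_apply h).continuousAt
  have hΦ : ContinuousAt Φ π := by
    refine ContinuousAt.sub (tendsto_finsetSum _ fun h _ => ?_)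
      (tendsto_finsetSum _ fun h _ => ?_)
    · exact (hap h).mul ((hap h).log (hπ h).ne')
    · exact (hap h).mul (ContinuousAt.comp (g := fun ζ => Real.log (predFreq (M θ₀) ζ h))
        (hcont h) hA)
  have hΦ0 : Φ π = 0 := by simp [Φ, logLik, hfix]
  -- A squared Hellinger distance of at most `(ε / 6) ^ 2` moves each frequency by at most `ε / 3`,
  -- leaving `ε / 2` for the distance from `p` to `π`.
  have hη : (0 : ℝ) < (ε / 6) ^ 2 := by positivity
  filter_upwards [hA.eventually hV, eventually_all.2 fun h => (hap h).eventually (lt_mem_nhds (hπ h)),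
    hΦ.eventually (gt_mem_nhds (hΦ0.trans_lt hη)), Metric.ball_mem_nhds π (half_pos hε)]
    with p hpV hp0 hpΦ hpball hp1 θ hθ
  refine hVW θ hθ.1 _ hpV (hball ?_)
  have hAp := marginMatrix_mulVec_pos hp0
  have hq0 := predFreq_pos (hM θ hθ.1) hAp
  have hq1 := sum_predFreq (hM θ hθ.1) hAp
  have h1 : ∑ h, (√(p h) - √(predFreq (M θ) ((marginMatrix X Y).mulVec p) h)) ^ 2 ≤
      (ε / 6) ^ 2 := by
    have h2 := sum_sqrt_sub_sqrt_sq_le hp0 hq0 hp1 hq1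
    have h3 := hθ.2 θ₀ hθ₀
    have h4 : logLik M p θ ((marginMatrix X Y).mulVec p) =
      ∑ h, p h * Real.log (predFreq (M θ) ((marginMatrix X Y).mulVec p) h) := rfl
    simp only [Φ] at hpΦ
    linarith
  have h5 := abs_sub_le_of_sum_sqrt_sub_sqrt_sq_le hp0 hq0 hp1 hq1 (by positivity) h1
  rw [Metric.mem_ball, dist_pi_lt_iff hε]
  rw [Metric.mem_ball, dist_pi_lt_iff (half_pos hε)] at hpball
  intro h
  have h6 := hpball h
  rw [dist_comm] at h6
  calc dist _ _ ≤ dist (predFreq (M θ) ((marginMatrix X Y).mulVec p) h) (p h) +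
        dist (p h) (π h) := dist_triangle _ _ _
    _ < ε / 3 + ε / 2 := by
        refine add_lt_add_of_le_of_lt ?_ (hpball h)
        rw [dist_comm, Real.dist_eq]
        linarith [h5 h]
    _ < ε := by linarith

/-- The influence matrix of the maximum likelihood estimate: the linear map which sends the
sampling error of the frequencies to the leading term of the estimation error. -/
noncomputable def influence (M : EuclideanSpace ℝ (Fin d) → X → Y → ℝ → ℝ → ℝ)
    (θ : EuclideanSpace ℝ (Fin d)) (π : Household X Y → ℝ) : Matrix (Fin d) (Household X Y) ℝ :=
  (info11 M θ π)⁻¹ * ((dThetaLog M θ ((marginMatrix X Y).mulVec π)).transpose -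
    info12 M θ π * marginMatrix X Y)

variable {ζ₀ : X ⊕ Y → ℝ}

theorem fderiv_logFreq_apply {h : Household X Y}
    (hd : DifferentiableAt ℝ (logFreq M h) (θ₀, ζ₀))
    (u : EuclideanSpace ℝ (Fin d)) (w : X ⊕ Y → ℝ) :
    fderiv ℝ (logFreq M h) (θ₀, ζ₀) (u, w) =
      (dThetaLog M θ₀ ζ₀).mulVec u h + (dZetaLog M θ₀ ζ₀).mulVec w h := by
  set D := fderiv ℝ (logFreq M h) (θ₀, ζ₀) with hD
  have h1 : ∀ v, fderiv ℝ (fun t => Real.log (predFreq (M t) ζ₀ h)) θ₀ v = D (v, 0) := fun v => by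
    have := (HasFDerivAt.comp (g := logFreq M h) (f := fun t => (t, ζ₀)) θ₀ hd.hasFDerivAt
      (hasFDerivAt_prodMk_left θ₀ ζ₀)).fderiv
    exact DFunLike.congr_fun this v
  have h2 : ∀ v, fderiv ℝ (fun q => Real.log (predFreq (M θ₀) q h)) ζ₀ v = D (0, v) := fun v => by
    have := (HasFDerivAt.comp (g := logFreq M h) ζ₀ hd.hasFDerivAt
      (hasFDerivAt_prodMk_right θ₀ ζ₀)).fderiv
    exact DFunLike.congr_fun this v
  have h3 : (u, w) = ((u, 0) : EuclideanSpace ℝ (Fin d) × (X ⊕ Y → ℝ)) + (0, w) := by simp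
  rw [h3, map_add, ← h1, ← h2]
  congr 1
  · conv_lhs => rw [← (EuclideanSpace.basisFun (Fin d) ℝ).sum_repr u]
    simp [Matrix.mulVec, dotProduct, dThetaLog, mul_comm]
  · conv_lhs => rw [pi_eq_sum_univ' w]
    simp [Matrix.mulVec, dotProduct, dZetaLog, mul_comm]

/-- The margins `A p` stay fixed while `θ` varies, so the first-order condition involves the
directions `(u, 0)` only. -/
theorem score_eq_zero_of_isMLE {p : Household X Y → ℝ} {θ : EuclideanSpace ℝ (Fin d)}
    (hθ : IsMLE M Θ p θ) (hint : θ ∈ interior Θ)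
    (hd : ∀ h, DifferentiableAt ℝ (logFreq M h) (θ, (marginMatrix X Y).mulVec p))
    (u : EuclideanSpace ℝ (Fin d)) :
    ∑ h, p h * fderiv ℝ (logFreq M h) (θ, (marginMatrix X Y).mulVec p) (u, 0) = 0 := by
  have hmax : IsLocalMax (fun t => logLik M p t ((marginMatrix X Y).mulVec p)) θ := by
    filter_upwards [isOpen_interior.mem_nhds hint] with t ht using hθ.2 t (interior_subset ht)
  have hder := HasFDerivAt.fun_sum (u := Finset.univ) fun h _ =>
    (HasFDerivAt.comp (g := logFreq M h)
      (f := fun t => (t, (marginMatrix X Y).mulVec p)) θ (hd h).hasFDerivAt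
      (hasFDerivAt_prodMk_left θ ((marginMatrix X Y).mulVec p))).const_mul (p h)
  have h0 := DFunLike.congr_fun (hmax.hasFDerivAt_eq_zero hder) u
  simpa using h0

omit [DecidableEq X] [DecidableEq Y] in
theorem eventually_interior_and_pos (hθ₀ : θ₀ ∈ interior Θ) (hζ₀ : ∀ z, 0 < ζ₀ z) :
    ∀ᶠ q : EuclideanSpace ℝ (Fin d) × (X ⊕ Y → ℝ) in 𝓝 (θ₀, ζ₀),
      q.1 ∈ interior Θ ∧ ∀ z, 0 < q.2 z := by
  refine (continuousAt_fst.eventually (isOpen_interior.mem_nhds hθ₀)).and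
    (eventually_all.2 fun z => ?_)
  have : ContinuousAt (fun q : EuclideanSpace ℝ (Fin d) × (X ⊕ Y → ℝ) => q.2 z) (θ₀, ζ₀) := by
    fun_prop
  exact this.eventually (lt_mem_nhds (hζ₀ z))

theorem eventually_sum_exp_logFreq [Nonempty (Household X Y)]
    (hM : ∀ θ ∈ Θ, ∀ x y, IsMatchingFunction (M θ x y)) (hθ₀ : θ₀ ∈ interior Θ)
    (hζ₀ : ∀ z, 0 < ζ₀ z) : ∀ᶠ q in 𝓝 (θ₀, ζ₀), ∑ h, Real.exp (logFreq M h q) = 1 := by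
  filter_upwards [eventually_interior_and_pos hθ₀ hζ₀] with q hq
  have hMq := hM q.1 (interior_subset hq.1)
  simp only [logFreq, Real.exp_log (predFreq_pos hMq hq.2 _)]
  exact sum_predFreq hMq hq.2

/-- Maximum likelihood estimates are asymptotically linear in the observed frequencies. -/
theorem eventually_norm_isMLE_sub_le [Nonempty (Household X Y)]
    (hM : ∀ θ ∈ Θ, ∀ x y, IsMatchingFunction (M θ x y)) (hθ₀ : θ₀ ∈ interior Θ)
    (hπ : ∀ h, 0 < π h) (hfix : predFreq (M θ₀) ((marginMatrix X Y).mulVec π) = π)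
    (hG : ∀ h, ContDiffAt ℝ 2 (logFreq M h) (θ₀, (marginMatrix X Y).mulVec π))
    (hident : IsIdentified M Θ θ₀ π) (hinfo : IsUnit (info11 M θ₀ π).det)
    {ε : ℝ} (hε : 0 < ε) :
    ∀ᶠ p in 𝓝 π, ∑ h, p h = 1 → ∀ θ, IsMLE M Θ p θ →
      ‖θ - θ₀ - WithLp.toLp 2 ((influence M θ₀ π).mulVec (p - π))‖ ≤ ε * ‖p - π‖ := by
  obtain ⟨A, hA⟩ : ∃ A : (Household X Y → ℝ) →L[ℝ] (X ⊕ Y → ℝ),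
      ∀ p, (marginMatrix X Y).mulVec p = A p :=
    ⟨LinearMap.toContinuousLinearMap (marginMatrix X Y).mulVecLin, fun p => rfl⟩
  have hAπ := marginMatrix_mulVec_pos hπ
  simp only [hA] at hfix hG hAπ
  have hsum := eventually_sum_exp_logFreq hM hθ₀ hAπ
  have hexp : ∀ h, Real.exp (logFreq M h (θ₀, A π)) = π h := fun h => by
    simp only [logFreq, hfix, Real.exp_log (hπ h)]
  choose S hS hSapp using fun k : Fin d =>
    exists_hasFDerivAt_score A hG hsum hexp (EuclideanSpace.single k 1, 0)
  let toE : (Fin d → ℝ) →L[ℝ] EuclideanSpace ℝ (Fin d) :=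
    (PiLp.continuousLinearEquiv 2 ℝ fun _ : Fin d => ℝ).symm
  let C : (Household X Y → ℝ) →L[ℝ] EuclideanSpace ℝ (Fin d) :=
    toE.comp (LinearMap.toContinuousLinearMap (influence M θ₀ π).mulVecLin)
  let J : (Fin d → ℝ) →L[ℝ] EuclideanSpace ℝ (Fin d) :=
    toE.comp (LinearMap.toContinuousLinearMap (info11 M θ₀ π)⁻¹.mulVecLin)
  have hT := hasFDerivAt_pi.2 hS
  have hsingle : ∀ h k, fderiv ℝ (logFreq M h) (θ₀, A π) (EuclideanSpace.single k 1, 0) =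
      dThetaLog M θ₀ (A π) h k := fun h k => by
    rw [fderiv_logFreq_apply ((hG h).differentiableAt (by norm_num))]
    simp
  have hT0 : ∀ k : Fin d, ∑ h, π h * fderiv ℝ (logFreq M h) (θ₀, A π) (EuclideanSpace.single k 1, 0) = 0 :=
    fun k => by
      have h1 := DFunLike.congr_fun (eventually_sum_exp_smul_fderiv_eq_zero hG hsum).self_of_nhds
        (EuclideanSpace.single k 1, 0)
      simpa [hexp] using h1
  -- Inverting the information solves the linearized score equation for the estimation error.
  have hJ : ∀ δ u, J (ContinuousLinearMap.pi S (δ, u)) = C δ - u := fun δ u => by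
    have h1 : ContinuousLinearMap.pi S (δ, u) =
        ((dThetaLog M θ₀ (A π)).transpose - info12 M θ₀ π * marginMatrix X Y).mulVec δ -
          (info11 M θ₀ π).mulVec u := by
      have h2 : ((dThetaLog M θ₀ (A π)).transpose - info12 M θ₀ π * marginMatrix X Y).mulVec δ -
          (info11 M θ₀ π).mulVec u = (dThetaLog M θ₀ (A π)).transpose.mulVec
            (δ - (Matrix.diagonal π).mulVec ((dThetaLog M θ₀ (A π)).mulVec u +
              (dZetaLog M θ₀ (A π)).mulVec (A δ))) := by
        simp only [info11, info12, hA π, ← hA δ, Matrix.sub_mulVec, Matrix.mulVec_sub, Matrix.mulVec_add,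
          Matrix.mulVec_mulVec, Matrix.mul_assoc]
        abel
      rw [h2]
      funext k
      rw [ContinuousLinearMap.pi_apply, hSapp, Matrix.mulVec]
      simp only [hsingle, fderiv_logFreq_apply ((hG _).differentiableAt (by norm_num)),
        Matrix.mulVec_diagonal, dotProduct, Matrix.transpose_apply, Pi.sub_apply,
        Pi.add_apply, ← Finset.sum_sub_distrib]
      exact Finset.sum_congr rfl fun h _ => by ring
    have h3 : (info11 M θ₀ π)⁻¹.mulVec ((info11 M θ₀ π).mulVec u) = u := by
      rw [Matrix.mulVec_mulVec, Matrix.nonsing_inv_mul _ hinfo, Matrix.one_mulVec]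
    rw [h1]
    change WithLp.toLp 2 ((info11 M θ₀ π)⁻¹.mulVec _) =
      WithLp.toLp 2 ((influence M θ₀ π).mulVec δ) - u
    rw [Matrix.mulVec_sub, h3, influence, ← Matrix.mulVec_mulVec, hA π]
    rfl
  have hzero := eventually_norm_zero_sub_le hT (funext hT0) C J hJ hε
  have hdiff : ∀ᶠ r : (Household X Y → ℝ) × EuclideanSpace ℝ (Fin d) in 𝓝 (π, θ₀),
      r.2 ∈ interior Θ ∧ ∀ h, DifferentiableAt ℝ (logFreq M h) (r.2, A r.1) := by
    have hc : Tendsto (fun r : (Household X Y → ℝ) × EuclideanSpace ℝ (Fin d) => (r.2, A r.1))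
        (𝓝 (π, θ₀)) (𝓝 (θ₀, A π)) :=
      Continuous.tendsto (by fun_prop) (π, θ₀)
    refine (continuousAt_snd.eventually (isOpen_interior.mem_nhds hθ₀)).and
      (eventually_all.2 fun h => hc.eventually ?_)
    filter_upwards [(hG h).eventually (by simp)] with q hq using hq.differentiableAt (by norm_num)
  -- Linearization holds only for `(p, θ)` in a product neighbourhood `V × U`; consistency then
  -- places every estimate in `U`.
  obtain ⟨V, hV, U, hU, hVU⟩ := mem_nhds_prod_iff.1 (hzero.and hdiff)
  have hcont : ∀ h, ContinuousAt (fun ζ => Real.log (predFreq (M θ₀) ζ h))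
      (A π) := fun h =>
    ContinuousAt.comp (g := logFreq M h) (f := fun ζ => (θ₀, ζ)) (hG h).continuousAt (by fun_prop)
  filter_upwards [hV, eventually_isMLE_mem hM (interior_subset hθ₀) hπ
    (by rw [hA, hfix]) (by simpa only [hA] using hcont)
    hident hU] with p hpV hpU hp1 θ hθ
  obtain ⟨h1, h2, h3⟩ := hVU (⟨hpV, hpU hp1 θ hθ⟩ : (p, θ) ∈ V ×ˢ U)
  simp only [← hA] at h1 h3
  exact h1 (funext fun k => score_eq_zero_of_isMLE hθ h2 h3 _)

end Deterministic

/-! ### The asymptotic covariance and the vanishing cross term -/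

section Covariance

variable {X Y : Type*} [Fintype X] [Fintype Y] [DecidableEq X] [DecidableEq Y] {d : ℕ}
  {M : EuclideanSpace ℝ (Fin d) → X → Y → ℝ → ℝ → ℝ} {Θ : Set (EuclideanSpace ℝ (Fin d))}
  {θ₀ : EuclideanSpace ℝ (Fin d)} {π : Household X Y → ℝ}

omit [Fintype X] [Fintype Y] in
theorem transpose_freqCov : (freqCov π).transpose = freqCov π := by
  rw [freqCov, Matrix.transpose_sub, Matrix.diagonal_transpose, Matrix.transpose_vecMulVec]

theorem fderiv_logFreq_single {ζ₀ : X ⊕ Y → ℝ} {h : Household X Y}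
    (hd : DifferentiableAt ℝ (logFreq M h) (θ₀, ζ₀)) (k : Fin d) :
    fderiv ℝ (logFreq M h) (θ₀, ζ₀) (EuclideanSpace.single k 1, 0) = dThetaLog M θ₀ ζ₀ h k := by
  rw [fderiv_logFreq_apply hd]
  simp

/-- Homogeneity: the predicted frequencies do not change with the scale of the margins. -/
theorem dZetaLog_mulVec_self (hM : ∀ x y, IsMatchingFunction (M θ₀ x y))
    (hhom : ∀ x y, IsHomogeneousOne (M θ₀ x y)) {ζ₀ : X ⊕ Y → ℝ} (hζ₀ : ∀ z, 0 < ζ₀ z)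
    (hd : ∀ h, DifferentiableAt ℝ (logFreq M h) (θ₀, ζ₀)) :
    (dZetaLog M θ₀ ζ₀).mulVec ζ₀ = 0 := by
  funext h
  have h1 : HasFDerivAt (fun t : ℝ => (θ₀, ζ₀ + t • ζ₀))
      ((0 : ℝ →L[ℝ] EuclideanSpace ℝ (Fin d)).prod
        ((ContinuousLinearMap.id ℝ ℝ).smulRight ζ₀)) 0 :=
    (hasFDerivAt_const θ₀ (0 : ℝ)).prodMk (((hasFDerivAt_id (0 : ℝ)).smul_const ζ₀).const_add ζ₀)
  have h2 : HasFDerivAt (logFreq M h) (fderiv ℝ (logFreq M h) (θ₀, ζ₀))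
      ((fun t : ℝ => (θ₀, ζ₀ + t • ζ₀)) 0) := by
    simpa using (hd h).hasFDerivAt
  have h3 := h2.comp (0 : ℝ) h1
  have h4 : (logFreq M h ∘ fun t : ℝ => (θ₀, ζ₀ + t • ζ₀)) =ᶠ[𝓝 0]
      fun _ => logFreq M h (θ₀, ζ₀) := by
    filter_upwards [lt_mem_nhds (show (-1 : ℝ) < 0 by norm_num)] with t ht
    have : ζ₀ + t • ζ₀ = (1 + t) • ζ₀ := by rw [add_smul, one_smul]
    simp only [Function.comp, logFreq]
    rw [this, predFreq_smul hM hhom hζ₀ (by linarith)]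
  have h5 := DFunLike.congr_fun
    (h3.unique ((hasFDerivAt_const (logFreq M h (θ₀, ζ₀)) (0 : ℝ)).congr_of_eventuallyEq h4)) 1
  have h6 := fderiv_logFreq_apply (hd h) 0 ζ₀
  simp only [WithLp.ofLp_zero, Matrix.mulVec_zero, Pi.zero_apply, zero_add] at h6
  rw [← h6, Pi.zero_apply]
  simpa using h5

/-- The margins of the predicted frequencies are always proportional to the given margins. -/
theorem exists_transpose_mul_diagonal_mul_margin
    (hM : ∀ θ ∈ Θ, ∀ x y, IsMatchingFunction (M θ x y)) (hθ₀ : θ₀ ∈ interior Θ)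
    (hπ : ∀ h, 0 < π h) (hfix : predFreq (M θ₀) ((marginMatrix X Y).mulVec π) = π)
    (hd : ∀ h, DifferentiableAt ℝ (logFreq M h) (θ₀, (marginMatrix X Y).mulVec π)) :
    ∃ c : Fin d → ℝ, (dThetaLog M θ₀ ((marginMatrix X Y).mulVec π)).transpose *
      Matrix.diagonal π * (marginMatrix X Y).transpose =
        Matrix.vecMulVec c ((marginMatrix X Y).mulVec π) := by
  have hζ₀ := marginMatrix_mulVec_pos hπ
  set ζ₀ := (marginMatrix X Y).mulVec π with hζ₀def
  have : ∀ h : Household X Y, Nonempty (Household X Y) := fun h => ⟨h⟩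
  have hentry : ∀ k z, ((dThetaLog M θ₀ ζ₀).transpose * Matrix.diagonal π *
      (marginMatrix X Y).transpose) k z =
        ∑ h, marginMatrix X Y z h * (π h * dThetaLog M θ₀ ζ₀ h k) := fun k z => by
    rw [Matrix.mul_apply]
    simp only [Matrix.mul_diagonal, Matrix.transpose_apply]
    exact Finset.sum_congr rfl fun h _ => by ring
  have hW : ∀ z, HasFDerivAt (fun t => (marginMatrix X Y).mulVec (predFreq (M t) ζ₀) z)
      (∑ h, marginMatrix X Y z h • (Real.exp (logFreq M h (θ₀, ζ₀)) •
        (fderiv ℝ (logFreq M h) (θ₀, ζ₀)).comp (ContinuousLinearMap.inl ℝ _ _))) θ₀ := fun z => by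
    have h1 := HasFDerivAt.fun_sum (u := Finset.univ) fun h _ =>
      ((HasFDerivAt.comp (g := logFreq M h) (f := fun t => (t, ζ₀)) θ₀ (hd h).hasFDerivAt
        (hasFDerivAt_prodMk_left θ₀ ζ₀)).exp).const_mul (marginMatrix X Y z h)
    refine h1.congr_of_eventuallyEq ?_
    filter_upwards [isOpen_interior.mem_nhds hθ₀] with t ht
    refine Finset.sum_congr rfl fun h _ => ?_
    have := this h
    simp only [Function.comp, logFreq,
      Real.exp_log (predFreq_pos (hM t (interior_subset ht)) hζ₀ h)]
  -- Cross-multiplying two coordinates of the proportionality `A Π(t, ζ₀) ∝ ζ₀` eliminates the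
  -- factor, which depends on `t`; the resulting identity is then differentiated in `t`.
  have hcross : ∀ k z w, (∑ h, marginMatrix X Y z h * (π h * dThetaLog M θ₀ ζ₀ h k)) * ζ₀ w =
      (∑ h, marginMatrix X Y w h * (π h * dThetaLog M θ₀ ζ₀ h k)) * ζ₀ z := fun k z w => by
    have h1 := ((hW z).mul_const (ζ₀ w)).sub ((hW w).mul_const (ζ₀ z))
    have h2 := DFunLike.congr_fun (h1.unique ((hasFDerivAt_const (0 : ℝ) θ₀).congr_of_eventuallyEq
      (by
        filter_upwards [isOpen_interior.mem_nhds hθ₀] with t ht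
        simp only [Pi.sub_apply, marginMatrix_mulVec_predFreq (hM t (interior_subset ht)) hζ₀,
          Pi.smul_apply, smul_eq_mul]
        ring))) (EuclideanSpace.single k 1)
    have hexp : ∀ h, Real.exp (logFreq M h (θ₀, ζ₀)) = π h := fun h => by
      simp only [logFreq, hfix, Real.exp_log (hπ h)]
    simp only [_root_.sub_apply, _root_.smul_apply, _root_.sum_apply,
      ContinuousLinearMap.comp_apply, ContinuousLinearMap.inl_apply, smul_eq_mul, hexp,
      fderiv_logFreq_single (hd _), _root_.zero_apply] at h2
    linarith
  rcases isEmpty_or_nonempty (X ⊕ Y) with hemp | ⟨⟨w⟩⟩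
  · exact ⟨0, Matrix.ext fun k z => hemp.elim z⟩
  · refine ⟨fun k => (∑ h, marginMatrix X Y w h * (π h * dThetaLog M θ₀ ζ₀ h k)) / ζ₀ w,
      Matrix.ext fun k z => ?_⟩
    rw [hentry, Matrix.vecMulVec_apply, div_mul_eq_mul_div, eq_div_iff (hζ₀ w).ne']
    exact hcross k z w

/-- The score has mean zero. Thus the rank-one part of `V_π` drops out next to `L'`. -/
theorem dThetaLog_transpose_mulVec [Nonempty (Household X Y)]
    (hM : ∀ θ ∈ Θ, ∀ x y, IsMatchingFunction (M θ x y)) (hθ₀ : θ₀ ∈ interior Θ)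
    (hπ : ∀ h, 0 < π h) (hfix : predFreq (M θ₀) ((marginMatrix X Y).mulVec π) = π)
    (hG : ∀ h, ContDiffAt ℝ 2 (logFreq M h) (θ₀, (marginMatrix X Y).mulVec π)) :
    (dThetaLog M θ₀ ((marginMatrix X Y).mulVec π)).transpose.mulVec π = 0 := by
  have hAπ := marginMatrix_mulVec_pos hπ
  have hsum := eventually_sum_exp_logFreq hM hθ₀ hAπ
  funext k
  have h1 := DFunLike.congr_fun (eventually_sum_exp_smul_fderiv_eq_zero hG hsum).self_of_nhds
    (EuclideanSpace.single k 1, 0)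
  have hexp : ∀ h, Real.exp (logFreq M h (θ₀, (marginMatrix X Y).mulVec π)) = π h := fun h => by
    simp only [logFreq, hfix, Real.exp_log (hπ h)]
  simp only [_root_.sum_apply, _root_.smul_apply, hexp, smul_eq_mul, _root_.zero_apply,
    fderiv_logFreq_single ((hG _).differentiableAt (by norm_num))] at h1
  rw [Pi.zero_apply, ← h1]
  simp only [Matrix.mulVec, dotProduct, Matrix.transpose_apply, mul_comm]

/-- The covariance of the influence of one observation is the asymptotic covariance. -/
theorem influence_mul_freqCov_mul_transpose [Nonempty (Household X Y)]
    (hM : ∀ θ ∈ Θ, ∀ x y, IsMatchingFunction (M θ x y))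
    (hhom : ∀ x y, IsHomogeneousOne (M θ₀ x y)) (hθ₀ : θ₀ ∈ interior Θ)
    (hπ : ∀ h, 0 < π h) (hfix : predFreq (M θ₀) ((marginMatrix X Y).mulVec π) = π)
    (hG : ∀ h, ContDiffAt ℝ 2 (logFreq M h) (θ₀, (marginMatrix X Y).mulVec π))
    (hinfo : IsUnit (info11 M θ₀ π).det) :
    influence M θ₀ π * freqCov π * (influence M θ₀ π).transpose = thetaCov M θ₀ π := by
  have hd := fun h => (hG h).differentiableAt (by norm_num)
  have hLπ := dThetaLog_transpose_mulVec hM hθ₀ hπ hfix hG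
  have hZ := dZetaLog_mulVec_self (hM θ₀ (interior_subset hθ₀)) hhom
    (marginMatrix_mulVec_pos hπ) hd
  obtain ⟨c, hc⟩ := exists_transpose_mul_diagonal_mul_margin hM hθ₀ hπ hfix hd
  have hI12 : (info12 M θ₀ π).mulVec ((marginMatrix X Y).mulVec π) = 0 := by
    rw [info12, ← Matrix.mulVec_mulVec, hZ, Matrix.mulVec_zero]
  have hI11 : info11 M θ₀ π = (dThetaLog M θ₀ ((marginMatrix X Y).mulVec π)).transpose *
      Matrix.diagonal π * dThetaLog M θ₀ ((marginMatrix X Y).mulVec π) := rfl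
  rw [influence, thetaCov]
  set L := dThetaLog M θ₀ ((marginMatrix X Y).mulVec π)
  set A := marginMatrix X Y
  set I₁₁ := info11 M θ₀ π
  set I₁₂ := info12 M θ₀ π
  set V := freqCov π with hV
  have hVt : V.transpose = V := transpose_freqCov
  have hLV : L.transpose * V = L.transpose * Matrix.diagonal π := by
    rw [hV, freqCov, Matrix.mul_sub, Matrix.mul_vecMulVec, hLπ, Matrix.zero_vecMulVec, sub_zero]
  have hVL : V * L = Matrix.diagonal π * L := by
    have := congrArg Matrix.transpose hLV
    simpa [Matrix.transpose_mul, hVt] using this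
  -- Both facts meet here: `L' diag(π) A'` equals `c ζ'` for some `c`, and `I₁₂ ζ = 0`.
  have hcross : L.transpose * V * (A.transpose * I₁₂.transpose) = 0 := by
    rw [hLV, ← Matrix.mul_assoc, hc, Matrix.vecMulVec_mul, Matrix.vecMul_transpose, hI12,
      Matrix.vecMulVec_zero]
  have hcross' : I₁₂ * A * V * L = 0 := by
    have := congrArg Matrix.transpose hcross
    simpa [Matrix.transpose_mul, hVt, Matrix.mul_assoc] using this
  have hLVL : L.transpose * V * L = I₁₁ := by rw [hLV, hI11]
  have hsymm : (I₁₁⁻¹).transpose = I₁₁⁻¹ := by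
    rw [Matrix.transpose_nonsing_inv]
    congr 1
    rw [hI11]
    simp [Matrix.transpose_mul, Matrix.mul_assoc]
  have hmid : (L.transpose - I₁₂ * A) * V * (L - A.transpose * I₁₂.transpose) =
      I₁₁ + I₁₂ * A * V * A.transpose * I₁₂.transpose := by
    rw [Matrix.sub_mul, Matrix.mul_sub, Matrix.sub_mul, Matrix.sub_mul, hLVL, hcross, hcross']
    simp [Matrix.mul_assoc]
  rw [Matrix.transpose_mul, Matrix.transpose_sub, Matrix.transpose_transpose,
    Matrix.transpose_mul, hsymm]
  calc I₁₁⁻¹ * (L.transpose - I₁₂ * A) * V * ((L - A.transpose * I₁₂.transpose) * I₁₁⁻¹)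
      = I₁₁⁻¹ * ((L.transpose - I₁₂ * A) * V * (L - A.transpose * I₁₂.transpose)) * I₁₁⁻¹ := by
        simp only [Matrix.mul_assoc]
    _ = _ := by
        rw [hmid, Matrix.mul_add, Matrix.add_mul, Matrix.nonsing_inv_mul _ hinfo, Matrix.one_mul]
        simp only [Matrix.mul_assoc]

theorem dotProduct_freqCov_mulVec (c : Household X Y → ℝ) :
    c ⬝ᵥ (freqCov π).mulVec c = ∑ h, π h * c h ^ 2 - (∑ h, π h * c h) ^ 2 := by
  rw [freqCov, Matrix.sub_mulVec, dotProduct_sub, Matrix.vecMulVec_mulVec]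
  simp only [dotProduct, Matrix.mulVec_diagonal, Pi.smul_apply, MulOpposite.smul_eq_mul_unop,
    MulOpposite.unop_op, sq, Finset.sum_mul_sum]
  congr 1
  · exact Finset.sum_congr rfl fun h _ => by ring
  · refine Finset.sum_congr rfl fun h _ => ?_
    rw [Finset.mul_sum, Finset.mul_sum]
    exact Finset.sum_congr rfl fun h' _ => by ring

theorem posSemidef_freqCov (hπ : ∀ h, 0 ≤ π h) (hsum : ∑ h, π h = 1) :
    (freqCov π).PosSemidef := by
  refine Matrix.PosSemidef.of_dotProduct_mulVec_nonneg ?_ fun c => ?_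
  · rw [Matrix.IsHermitian, Matrix.conjTranspose_eq_transpose_of_trivial, transpose_freqCov]
  · rw [star_trivial, dotProduct_freqCov_mulVec, sub_nonneg]
    exact Real.pow_arith_mean_le_arith_mean_pow_of_even _ _ _ (fun h _ => hπ h) hsum even_two

end Covariance

end MatchingMLE

instance {X Y : Type*} : DiscreteMeasurableSpace (Household X Y) := ⟨fun _ => trivial⟩

namespace MatchingMLE

/-! ### Reduction of convergence in distribution to projections -/

theorem charFun_map_eq_charFun_map_inner {Ω E : Type*} [MeasurableSpace Ω] {P : Measure Ω}
    [NormedAddCommGroup E] [InnerProductSpace ℝ E] [FiniteDimensional ℝ E] [MeasurableSpace E]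
    [BorelSpace E] {V : Ω → E} (hV : AEMeasurable V P) (t : E) :
    charFun (P.map V) t = charFun (P.map fun ω => inner ℝ (V ω) t) 1 := by
  rw [charFun_apply, charFun_apply_real, integral_map hV (by fun_prop),
    integral_map (by fun_prop) (by fun_prop)]
  simp

/-- Convergence in distribution in a Euclidean space follows from that of all projections. -/
theorem tendstoInDistribution_of_inner {Ω Ω' E : Type*} [MeasurableSpace Ω] [MeasurableSpace Ω']
    {P : Measure Ω} [IsProbabilityMeasure P] {P' : Measure Ω'} [IsProbabilityMeasure P']
    [NormedAddCommGroup E] [InnerProductSpace ℝ E] [FiniteDimensional ℝ E] [MeasurableSpace E]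
    [BorelSpace E] {U : ℕ → Ω → E} {Z : Ω' → E} (hU : ∀ n, AEMeasurable (U n) P)
    (hZ : AEMeasurable Z P')
    (h : ∀ t, TendstoInDistribution (fun n ω => inner ℝ (U n ω) t) atTop
      (fun ω => inner ℝ (Z ω) t) (fun _ => P) P') :
    TendstoInDistribution U atTop Z (fun _ => P) P' where
  forall_aemeasurable := hU
  aemeasurable_limit := hZ
  tendsto := by
    refine ProbabilityMeasure.tendsto_iff_tendsto_charFun.2 fun t => ?_
    have h1 := ProbabilityMeasure.tendsto_iff_tendsto_charFun.1 (h t).tendsto 1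
    simp only [ProbabilityMeasure.coe_mk] at h1 ⊢
    rw [charFun_map_eq_charFun_map_inner hZ]
    simpa only [charFun_map_eq_charFun_map_inner (hU _)] using h1

/-! ### Limit theorems for the observed frequencies -/

section Sampling

variable {X Y : Type*} [Fintype X] [Fintype Y] [DecidableEq X] [DecidableEq Y]
  {π : Household X Y → ℝ} {Ω : Type*} [MeasurableSpace Ω] {P : Measure Ω} [IsProbabilityMeasure P]
  {H : ℕ → Ω → Household X Y}

omit [MeasurableSpace Ω] in
-- Grouping the sample by type turns a linear functional of the frequencies into a sample mean, to
-- which the scalar limit theorems apply.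
theorem sum_mul_empFreq (H : ℕ → Ω → Household X Y) (c : Household X Y → ℝ) (N : ℕ) (ω : Ω) :
    ∑ h, c h * empFreq H N ω h = (∑ k ∈ Finset.range N, c (H k ω)) / N := by
  rw [← Finset.sum_fiberwise (Finset.range N) (fun k => H k ω), Finset.sum_div]
  refine Finset.sum_congr rfl fun h _ => ?_
  rw [Finset.sum_congr rfl fun k hk => congrArg c (Finset.mem_filter.1 hk).2, Finset.sum_const,
    empFreq, nsmul_eq_mul]
  ring

omit [MeasurableSpace Ω] in
theorem sum_empFreq (H : ℕ → Ω → Household X Y) {N : ℕ} (hN : N ≠ 0) (ω : Ω) :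
    ∑ h, empFreq H N ω h = 1 := by
  have := sum_mul_empFreq H (fun _ => 1) N ω
  simpa [hN] using this

omit [MeasurableSpace Ω] in
theorem sqrt_mul_sum_empFreq_sub (c : Household X Y → ℝ) (N : ℕ) (ω : Ω) :
    √(N : ℝ) * ∑ h, c h * (empFreq H N ω h - π h) =
      (√(N : ℝ))⁻¹ * (∑ k ∈ Finset.range N, c (H k ω) - N * ∑ h, π h * c h) := by
  simp only [mul_sub, Finset.sum_sub_distrib, sum_mul_empFreq, mul_comm (c _) (π _)]
  rcases Nat.eq_zero_or_pos N with rfl | hN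
  · simp
  · have hN' : (0 : ℝ) < N := by exact_mod_cast hN
    have h1 := Real.sq_sqrt hN'.le
    have h2 := Real.sqrt_pos.2 hN'
    set r := √(N : ℝ)
    rw [← h1]
    field_simp

omit [DecidableEq X] [DecidableEq Y] in
theorem integral_comp_household (hH : ∀ i, Measurable (H i))
    (hlaw : ∀ i h, P.real {ω | H i ω = h} = π h) (c : Household X Y → ℝ) (i : ℕ) :
    ∫ ω, c (H i ω) ∂P = ∑ h, π h * c h := by
  have := Measure.isProbabilityMeasure_map (μ := P) (hH i).aemeasurable
  rw [← integral_map (hH i).aemeasurable (.of_discrete), integral_fintype .of_finite]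
  refine Finset.sum_congr rfl fun h _ => ?_
  rw [map_measureReal_apply (hH i) (.of_discrete), ← hlaw i h]
  rfl

omit [DecidableEq X] [DecidableEq Y] in
theorem memLp_comp_household (hH : ∀ i, Measurable (H i)) (c : Household X Y → ℝ) (i : ℕ) :
    MemLp (fun ω => c (H i ω)) 2 P := by
  refine MemLp.of_bound ((measurable_of_countable c).comp (hH i)).aestronglyMeasurable
    (∑ h, ‖c h‖) (Eventually.of_forall fun ω => ?_)
  exact Finset.single_le_sum (f := fun h => ‖c h‖) (fun _ _ => norm_nonneg _) (Finset.mem_univ _)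

theorem variance_comp_household (hH : ∀ i, Measurable (H i))
    (hlaw : ∀ i h, P.real {ω | H i ω = h} = π h) (c : Household X Y → ℝ) (i : ℕ) :
    Var[fun ω => c (H i ω); P] = c ⬝ᵥ (freqCov π).mulVec c := by
  rw [variance_eq_sub (memLp_comp_household hH c i), dotProduct_freqCov_mulVec,
    integral_comp_household hH hlaw]
  congr 1
  exact integral_comp_household hH hlaw (fun h => c h ^ 2) i

omit [DecidableEq X] [DecidableEq Y] in
theorem identDistrib_household (hH : ∀ i, Measurable (H i))
    (hlaw : ∀ i h, P.real {ω | H i ω = h} = π h) (i j : ℕ) : IdentDistrib (H i) (H j) P P := by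
  refine ⟨(hH i).aemeasurable, (hH j).aemeasurable, Measure.ext_of_singleton fun h => ?_⟩
  rw [Measure.map_apply (hH i) (.of_discrete), Measure.map_apply (hH j) (.of_discrete)]
  exact (measureReal_eq_measureReal_iff).1 ((hlaw i h).trans (hlaw j h).symm)

/-- The central limit theorem for linear functionals of the observed frequencies. -/
theorem tendstoInDistribution_sum_empFreq (hH : ∀ i, Measurable (H i)) (hindep : iIndepFun H P)
    (hlaw : ∀ i h, P.real {ω | H i ω = h} = π h) (c : Household X Y → ℝ) {Ω' : Type*}
    [MeasurableSpace Ω'] {P' : Measure Ω'} [IsProbabilityMeasure P'] {Z : Ω' → ℝ}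
    (hZ : HasLaw Z (gaussianReal 0 (c ⬝ᵥ (freqCov π).mulVec c).toNNReal) P') :
    TendstoInDistribution (fun (N : ℕ) ω => √(N : ℝ) * ∑ h, c h * (empFreq H N ω h - π h)) atTop Z
      (fun _ => P) P' := by
  have hc : Measurable c := measurable_of_countable c
  have h1 := tendstoInDistribution_inv_sqrt_mul_sum_sub (P := P) (X := fun i ω => c (H i ω))
    (by rwa [variance_comp_household hH hlaw]) (memLp_comp_household hH c 0)
    (hindep.comp (fun _ => c) fun _ => hc)
    (fun i => (identDistrib_household hH hlaw i 0).comp hc)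
  simp only [integral_comp_household hH hlaw] at h1
  simpa only [sqrt_mul_sum_empFreq_sub] using h1

/-- Chebyshev's inequality for linear functionals of the observed frequencies. -/
theorem measure_sqrt_mul_sum_empFreq_ge_le (hH : ∀ i, Measurable (H i)) (hindep : iIndepFun H P)
    (hlaw : ∀ i h, P.real {ω | H i ω = h} = π h) (c : Household X Y → ℝ) (N : ℕ) {K : ℝ}
    (hK : 0 < K) :
    P {ω | K ≤ |√(N : ℝ) * ∑ h, c h * (empFreq H N ω h - π h)|} ≤
      ENNReal.ofReal (c ⬝ᵥ (freqCov π).mulVec c / K ^ 2) := by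
  have hc : Measurable c := measurable_of_countable c
  have hL := memLp_comp_household (P := P) hH c
  have hS : MemLp (fun ω => (√(N : ℝ))⁻¹ * ∑ k ∈ Finset.range N, c (H k ω)) 2 P :=
    (memLp_finsetSum _ fun k _ => hL k).const_mul _
  have hmean : ∫ ω, (√(N : ℝ))⁻¹ * ∑ k ∈ Finset.range N, c (H k ω) ∂P =
      (√(N : ℝ))⁻¹ * (N * ∑ h, π h * c h) := by
    rw [integral_const_mul, integral_finsetSum _ fun k _ => (hL k).integrable (by norm_num)]
    simp [integral_comp_household hH hlaw]
  have hvar : Var[fun ω => (√(N : ℝ))⁻¹ * ∑ k ∈ Finset.range N, c (H k ω); P] ≤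
      c ⬝ᵥ (freqCov π).mulVec c := by
    have h1 : Var[∑ k ∈ Finset.range N, fun ω => c (H k ω); P] =
        N * (c ⬝ᵥ (freqCov π).mulVec c) := by
      rw [IndepFun.variance_sum (fun k _ => hL k) fun i _ j _ hij =>
        (hindep.indepFun hij).comp hc hc]
      simp [variance_comp_household hH hlaw]
    have h2 : (fun ω => (√(N : ℝ))⁻¹ * ∑ k ∈ Finset.range N, c (H k ω)) =
        fun ω => (√(N : ℝ))⁻¹ * (∑ k ∈ Finset.range N, fun ω => c (H k ω)) ω := by
      funext ω; simp
    rw [h2, variance_const_mul, h1, inv_pow, Real.sq_sqrt (Nat.cast_nonneg N), ← mul_assoc]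
    have h3 : 0 ≤ c ⬝ᵥ (freqCov π).mulVec c := by
      rw [← variance_comp_household hH hlaw c 0]
      exact variance_nonneg _ _
    exact mul_le_of_le_one_left h3 (inv_mul_le_one)
  have h4 := meas_ge_le_variance_div_sq hS hK
  rw [hmean] at h4
  simp only [← mul_sub] at h4
  simp only [sqrt_mul_sum_empFreq_sub]
  exact h4.trans (ENNReal.ofReal_le_ofReal (by gcongr))

/-- Union bound over the coordinates, each of variance `π h - π h ^ 2 ≤ 1`. The bound is uniform in
`N`, so the scaled sampling errors are tight. -/
theorem measure_sqrt_mul_norm_empFreq_ge_le (hH : ∀ i, Measurable (H i)) (hindep : iIndepFun H P)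
    (hlaw : ∀ i h, P.real {ω | H i ω = h} = π h) (N : ℕ) {K : ℝ} (hK : 0 < K) :
    P {ω | K ≤ √(N : ℝ) * ‖empFreq H N ω - π‖} ≤
      Fintype.card (Household X Y) * ENNReal.ofReal (1 / K ^ 2) := by
  have hsub : {ω | K ≤ √(N : ℝ) * ‖empFreq H N ω - π‖} ⊆
      ⋃ h, {ω | K ≤ |√(N : ℝ) * ∑ h', (Pi.single h 1 : Household X Y → ℝ) h' *
        (empFreq H N ω h' - π h')|} := by
    intro ω hω
    by_contra hcon
    simp only [Set.mem_iUnion, Set.mem_ofPred_eq, not_exists, not_le] at hcon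
    have h1 : ‖√(N : ℝ) • (empFreq H N ω - π)‖ < K := by
      refine (pi_norm_lt_iff hK).2 fun h => ?_
      simpa [Pi.single_apply] using hcon h
    rw [norm_smul, Real.norm_of_nonneg (Real.sqrt_nonneg _)] at h1
    exact absurd hω (not_le.2 h1)
  calc P {ω | K ≤ √(N : ℝ) * ‖empFreq H N ω - π‖}
      ≤ ∑ h, P {ω | K ≤ |√(N : ℝ) * ∑ h', (Pi.single h 1 : Household X Y → ℝ) h' *
        (empFreq H N ω h' - π h')|} := (measure_mono hsub).trans (measure_iUnion_fintype_le _ _)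
    _ ≤ ∑ _h : Household X Y, ENNReal.ofReal (1 / K ^ 2) := by
        refine Finset.sum_le_sum fun h _ =>
          (measure_sqrt_mul_sum_empFreq_ge_le hH hindep hlaw _ N hK).trans
            (ENNReal.ofReal_le_ofReal ?_)
        gcongr
        rw [dotProduct_freqCov_mulVec]
        have h1 : π h ≤ 1 := hlaw 0 h ▸ measureReal_le_one
        simp only [Pi.single_apply, ite_pow, one_pow, ne_eq, OfNat.ofNat_ne_zero,
          not_false_eq_true, zero_pow, mul_ite, mul_one, mul_zero, Finset.sum_ite_eq',
          Finset.mem_univ, if_true]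
        nlinarith [sq_nonneg (π h)]
    _ = _ := by simp

/-- An asymptotically linear estimator differs from its linearization by `o(N ^ (-1 / 2))` in
probability. -/
theorem tendstoInMeasure_sqrt_smul_sub (hH : ∀ i, Measurable (H i)) (hindep : iIndepFun H P)
    (hlaw : ∀ i h, P.real {ω | H i ω = h} = π h) {E : Type*} [NormedAddCommGroup E]
    [NormedSpace ℝ E] {θ₀ : E} {θhat : ℕ → Ω → E} {Q : (Household X Y → ℝ) → E → Prop}
    {B : (Household X Y → ℝ) → E}
    (hlin : ∀ ε > 0, ∀ᶠ p in 𝓝 π, ∑ h, p h = 1 → ∀ θ, Q p θ →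
      ‖θ - θ₀ - B (p - π)‖ ≤ ε * ‖p - π‖)
    (hQ : Tendsto (fun N => P {ω | ¬ Q (empFreq H N ω) (θhat N ω)}) atTop (𝓝 0)) :
    TendstoInMeasure P ((fun (N : ℕ) ω => √(N : ℝ) • (θhat N ω - θ₀)) -
      fun (N : ℕ) ω => √(N : ℝ) • B (empFreq H N ω - π)) atTop 0 := by
  refine tendstoInMeasure_iff_norm.2 fun ε hε => ENNReal.tendsto_nhds_zero.2 fun δ hδ => ?_
  have hδ2 : 0 < δ / 2 := ENNReal.half_pos hδ.ne'
  obtain ⟨K, hKδ, hK⟩ : ∃ K : ℝ, Fintype.card (Household X Y) * ENNReal.ofReal (1 / K ^ 2) ≤ δ / 2 ∧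
      0 < K := by
    have h1 : Tendsto (fun K : ℝ => 1 / K ^ 2) atTop (𝓝 0) := by
      simpa using (tendsto_pow_neg_atTop (𝕜 := ℝ) (n := 2) (by norm_num))
    have h2 := ENNReal.Tendsto.const_mul (a := (Fintype.card (Household X Y) : ENNReal))
      (ENNReal.tendsto_ofReal h1) (Or.inr (ENNReal.natCast_ne_top _))
    rw [ENNReal.ofReal_zero, mul_zero] at h2
    exact ((ENNReal.tendsto_nhds_zero.1 h2 _ hδ2).and (eventually_gt_atTop 0)).exists
  -- With slope `ε / (2 * K)` the scaled error is at most `ε / 2` wherever the scaled sampling error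
  -- is below `K`. Requiring `√N > K / r` then also puts the frequencies within `r` of `π`.
  obtain ⟨r, hr, hball⟩ := Metric.eventually_nhds_iff.1 (hlin (ε / (2 * K)) (by positivity))
  have hsqrt : ∀ᶠ N : ℕ in atTop, K / r < √(N : ℝ) :=
    (Real.tendsto_sqrt_atTop.comp tendsto_natCast_atTop_atTop).eventually_gt_atTop _
  filter_upwards [ENNReal.tendsto_nhds_zero.1 hQ _ hδ2, hsqrt, eventually_ne_atTop 0]
    with N hN1 hN2 hN3
  have hs : 0 < √(N : ℝ) := (div_pos hK hr).trans hN2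
  have hsub : {ω | ε ≤ ‖((fun (N : ℕ) ω => √(N : ℝ) • (θhat N ω - θ₀)) -
      fun (N : ℕ) ω => √(N : ℝ) • B (empFreq H N ω - π)) N ω - (0 : Ω → E) ω‖} ⊆
      {ω | ¬ Q (empFreq H N ω) (θhat N ω)} ∪ {ω | K ≤ √(N : ℝ) * ‖empFreq H N ω - π‖} := by
    intro ω hω
    by_contra hcon
    simp only [Set.mem_union, Set.mem_ofPred_eq, not_or, not_not, not_le] at hcon
    have h1 : dist (empFreq H N ω) π < r := by
      rw [dist_eq_norm]
      rw [div_lt_iff₀ hr] at hN2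
      exact lt_of_mul_lt_mul_left (hcon.2.trans hN2) hs.le
    have h2 := hball h1 (sum_empFreq H hN3 ω) _ hcon.1
    have h3 : ε ≤ √(N : ℝ) * ‖θhat N ω - θ₀ - B (empFreq H N ω - π)‖ := by
      simpa [← smul_sub, norm_smul, abs_of_pos hs] using hω
    have h4 : √(N : ℝ) * ‖θhat N ω - θ₀ - B (empFreq H N ω - π)‖ ≤
        ε / (2 * K) * (√(N : ℝ) * ‖empFreq H N ω - π‖) := by
      calc _ ≤ √(N : ℝ) * (ε / (2 * K) * ‖empFreq H N ω - π‖) := by gcongr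
        _ = _ := by ring
    have h5 : ε / (2 * K) * (√(N : ℝ) * ‖empFreq H N ω - π‖) ≤ ε / (2 * K) * K := by
      gcongr
      exact hcon.2.le
    have h6 : ε / (2 * K) * K = ε / 2 := by field_simp
    linarith
  calc _ ≤ P {ω | ¬ Q (empFreq H N ω) (θhat N ω)} +
        P {ω | K ≤ √(N : ℝ) * ‖empFreq H N ω - π‖} := (measure_mono hsub).trans (measure_union_le _ _)
    _ ≤ δ / 2 + δ / 2 :=
        add_le_add hN1 ((measure_sqrt_mul_norm_empFreq_ge_le hH hindep hlaw N hK).trans hKδ)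
    _ = δ := ENNReal.add_halves δ

theorem measurable_empFreq (hH : ∀ i, Measurable (H i)) (N : ℕ) :
    Measurable fun ω => empFreq H N ω := by
  refine measurable_pi_lambda _ fun h => ?_
  have h1 : ∀ ω, empFreq H N ω h =
      (∑ k ∈ Finset.range N, (Pi.single h 1 : Household X Y → ℝ) (H k ω)) / N := fun ω => by
    simpa [Pi.single_apply] using sum_mul_empFreq H (Pi.single h 1) N ω
  simp only [h1]
  exact (Finset.measurable_fun_sum _ fun k _ =>
    (measurable_of_countable (Pi.single h 1 : Household X Y → ℝ)).comp (hH k)).div_const _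

theorem hasLaw_inner_multivariateGaussian {d : ℕ} {S : Matrix (Fin d) (Fin d) ℝ}
    (hS : S.PosSemidef) (t : EuclideanSpace ℝ (Fin d)) :
    HasLaw (fun z : EuclideanSpace ℝ (Fin d) => inner ℝ z t)
      (gaussianReal 0 (t.ofLp ⬝ᵥ S.mulVec t.ofLp).toNNReal) (multivariateGaussian 0 S) where
  map_eq := by
    have h1 := IsGaussian.map_eq_gaussianReal (μ := multivariateGaussian 0 S) (innerSL ℝ t)
    have h2 : (⇑(innerSL ℝ t) : EuclideanSpace ℝ (Fin d) → ℝ) = fun z => inner ℝ z t := by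
      funext z; simp [real_inner_comm]
    have h4 : ∫ z, innerSL ℝ t z ∂multivariateGaussian 0 S = 0 :=
      ((innerSL ℝ t).integral_comp_comm IsGaussian.integrable_fun_id).trans (by simp)
    have h3 : Var[innerSL ℝ t; multivariateGaussian 0 S] = t.ofLp ⬝ᵥ S.mulVec t.ofLp := by
      rw [← covarianceBilin_multivariateGaussian hS t t,
        covarianceBilin_self IsGaussian.memLp_two_id]
      rfl
    rw [h3, h4, h2] at h1
    exact h1

/-- The central limit theorem for linear maps of the observed frequencies. -/
theorem tendstoInDistribution_mulVec_empFreq (hH : ∀ i, Measurable (H i))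
    (hindep : iIndepFun H P) (hlaw : ∀ i h, P.real {ω | H i ω = h} = π h) {d : ℕ}
    (B : Matrix (Fin d) (Household X Y) ℝ)
    (hS : (B * freqCov π * B.transpose).PosSemidef) :
    TendstoInDistribution
      (fun (N : ℕ) ω => √(N : ℝ) • WithLp.toLp 2 (B.mulVec (empFreq H N ω - π))) atTop
      (id : EuclideanSpace ℝ (Fin d) → EuclideanSpace ℝ (Fin d)) (fun _ => P)
      (multivariateGaussian 0 (B * freqCov π * B.transpose)) := by
  refine tendstoInDistribution_of_inner (fun N => ?_) aemeasurable_id fun t => ?_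
  · have h1 : Continuous fun p : Household X Y → ℝ =>
        √(N : ℝ) • WithLp.toLp 2 (B.mulVec (p - π)) := by
      have : Continuous fun p : Household X Y → ℝ => B.mulVec (p - π) :=
        continuous_const.matrix_mulVec (by fun_prop)
      fun_prop
    exact (h1.measurable.comp (measurable_empFreq hH N)).aemeasurable
  · have hlaw' := hasLaw_inner_multivariateGaussian hS t
    have hvar : t.ofLp ⬝ᵥ (B * freqCov π * B.transpose).mulVec t.ofLp =
        B.transpose.mulVec t.ofLp ⬝ᵥ (freqCov π).mulVec (B.transpose.mulVec t.ofLp) := by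
      rw [← Matrix.mulVec_mulVec, ← Matrix.mulVec_mulVec, Matrix.dotProduct_mulVec,
        ← Matrix.mulVec_transpose]
    rw [hvar] at hlaw'
    have h2 := tendstoInDistribution_sum_empFreq hH hindep hlaw _ hlaw'
    refine (iff_of_eq ?_).1 h2
    congr 1
    funext N ω
    rw [real_inner_smul_left]
    congr 1
    rw [EuclideanSpace.inner_eq_star_dotProduct, star_trivial, Matrix.dotProduct_mulVec,
      ← Matrix.mulVec_transpose]
    rfl

end Sampling

end MatchingMLE

theorem mainTheorem5 {X Y : Type*} [Fintype X] [Fintype Y] [DecidableEq X] [DecidableEq Y]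
    {d : ℕ}
    -- the parametric family of homogeneous matching functions
    (M : EuclideanSpace ℝ (Fin d) → X → Y → ℝ → ℝ → ℝ)
    (Θ : Set (EuclideanSpace ℝ (Fin d)))
    (hM : ∀ θ ∈ Θ, ∀ x y, MatchingMLE.IsMatchingFunction (M θ x y))
    (hhom : ∀ θ ∈ Θ, ∀ x y, MatchingMLE.IsHomogeneousOne (M θ x y))
    (hsmooth : ∀ x y, ContDiffOn ℝ 2
      (fun p : EuclideanSpace ℝ (Fin d) × ℝ × ℝ => M p.1 x y p.2.1 p.2.2)
      (interior Θ ×ˢ (Set.Ioi 0 ×ˢ Set.Ioi 0)))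
    -- the true parameter, the masses of men and women, the true frequencies
    (θ₀ : EuclideanSpace ℝ (Fin d)) (hθ₀ : θ₀ ∈ interior Θ)
    (n : X → ℝ) (hn : ∀ x, 0 < n x) (m : Y → ℝ) (hm : ∀ y, 0 < m y)
    (π : Household X Y → ℝ) (hπ : π = MatchingMLE.predFreq (M θ₀) (Sum.elim n m))
    (hident : MatchingMLE.IsIdentified M Θ θ₀ π)
    (hinfo : IsUnit (MatchingMLE.info11 M θ₀ π).det)
    -- the sample of households
    {Ω : Type*} [MeasurableSpace Ω] (P : Measure Ω) [IsProbabilityMeasure P]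
    (H : ℕ → Ω → Household X Y) (hH : ∀ i, Measurable (H i)) (hindep : iIndepFun H P)
    (hlaw : ∀ i h, P.real {ω | H i ω = h} = π h)
    -- the estimator
    (θhat : ℕ → Ω → EuclideanSpace ℝ (Fin d)) (hθhat : ∀ N, AEMeasurable (θhat N) P)
    (hmle : Tendsto
      (fun N => P {ω | ¬ MatchingMLE.IsMLE M Θ (MatchingMLE.empFreq H N ω) (θhat N ω)})
      atTop (𝓝 0)) :
    (∀ h, DifferentiableAt ℝ (fun θ => Real.log (MatchingMLE.predFreq (M θ)
        ((MatchingMLE.marginMatrix X Y).mulVec π) h)) θ₀) ∧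
    (∀ h, DifferentiableAt ℝ (fun ζ => Real.log (MatchingMLE.predFreq (M θ₀) ζ h))
        ((MatchingMLE.marginMatrix X Y).mulVec π)) ∧
    (MatchingMLE.thetaCov M θ₀ π).PosSemidef ∧
    TendstoInDistribution (fun (N : ℕ) ω => √(N : ℝ) • (θhat N ω - θ₀)) atTop
      (id : EuclideanSpace ℝ (Fin d) → EuclideanSpace ℝ (Fin d)) (fun _ => P)
      (multivariateGaussian 0 (MatchingMLE.thetaCov M θ₀ π)) := by
  have hne : Nonempty (Household X Y) := by
    have : Nonempty Ω := nonempty_of_isProbabilityMeasure P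
    exact this.map (H 0)
  have hM₀ := hM θ₀ (interior_subset hθ₀)
  have hhom₀ := hhom θ₀ (interior_subset hθ₀)
  have hnm : ∀ z, 0 < Sum.elim n m z := fun z => by rcases z with x | y <;> simp [hn, hm]
  have hπpos : ∀ h, 0 < π h := fun h => hπ ▸ MatchingMLE.predFreq_pos hM₀ hnm h
  have hπsum : ∑ h, π h = 1 := hπ ▸ MatchingMLE.sum_predFreq hM₀ hnm
  -- The margins `Aπ` differ from `(n, m)` by a scale factor only, so homogeneity gives the same
  -- frequencies.
  have hfix : MatchingMLE.predFreq (M θ₀) ((MatchingMLE.marginMatrix X Y).mulVec π) = π := by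
    rw [hπ]
    exact MatchingMLE.predFreq_mulVec_predFreq hM₀ hhom₀ hnm
  have hG := MatchingMLE.contDiffAt_logFreq hM hsmooth hθ₀
    (MatchingMLE.marginMatrix_mulVec_pos hπpos)
  have hd := fun h => (hG h).differentiableAt (by norm_num)
  have hcov := MatchingMLE.influence_mul_freqCov_mul_transpose hM hhom₀ hθ₀ hπpos hfix hG hinfo
  have hpsd : (MatchingMLE.thetaCov M θ₀ π).PosSemidef := by
    rw [← hcov, ← Matrix.conjTranspose_eq_transpose_of_trivial]
    exact (MatchingMLE.posSemidef_freqCov (fun h => (hπpos h).le)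
      hπsum).mul_mul_conjTranspose_same _
  refine ⟨fun h => ?_, fun h => ?_, hpsd, ?_⟩
  · exact DifferentiableAt.comp (g := MatchingMLE.logFreq M h)
      (f := fun θ => (θ, (MatchingMLE.marginMatrix X Y).mulVec π)) θ₀ (hd h) (by fun_prop)
  · exact DifferentiableAt.comp (g := MatchingMLE.logFreq M h)
      (f := fun ζ => (θ₀, ζ)) ((MatchingMLE.marginMatrix X Y).mulVec π) (hd h) (by fun_prop)
  · have hclt := MatchingMLE.tendstoInDistribution_mulVec_empFreq hH hindep hlaw
      (MatchingMLE.influence M θ₀ π) (hcov ▸ hpsd)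
    simp only [hcov] at hclt
    have hrem := MatchingMLE.tendstoInMeasure_sqrt_smul_sub hH hindep hlaw
      (Q := MatchingMLE.IsMLE M Θ)
      (B := fun δ => WithLp.toLp 2 ((MatchingMLE.influence M θ₀ π).mulVec δ))
      (fun ε hε => MatchingMLE.eventually_norm_isMLE_sub_le hM hθ₀ hπpos hfix hG hident hinfo hε)
      hmle
    -- Slutsky: the linearization has the Gaussian limit and the remainder tends to `0` in
    -- probability.
    exact tendstoInDistribution_of_tendstoInMeasure_sub _ _ hclt hrem
      fun N => ((hθhat N).sub_const θ₀).const_smul (√(N : ℝ))
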